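/- Let $m\ge 1$, let $V_1,\dots,V_m$ be 2-dimensional complex vector spaces and let $\mathfrak h$ be a complex vector space of dimension $m+1$. For $\ell\in\mathbb P(V_j)$, i.e. a 1-dimensional subspace $\ell\subset V_j$, let $\ell^0\subset V_j^*$ be its annihilator, regarded as a point of $\mathbb P(V_j^*)$, and let $\Sigma^0_{j,\ell}\subset V_1^*\otimes\cdots\otimes V_m^*=(V_1\otimes\cdots\otimes V_m)^*$ be the annihilator of $\Sigma_{j,\ell}=V_1\otimes\cdots\otimes V_{j-1}\otimes\ell\otimes V_{j+1}\otimes\cdots\otimes V_m$. "Generic" means: for all points of some non-empty Zariski open subset. Let $\varphi:\mathfrak h\to V_1^*\otimes\cdots\otimes V_m^*$ be a complex factorization structure of dimension $m$, that is, an injective linear map such that $\dim\big(\varphi(\mathfrak h)\cap\Sigma^0_{j,\ell}\big)=1$ for every $j\in\{1,\dots,m\}$ and generic $\ell\in\mathbb P(V_j)$. The factorization curve $\psi_j:\mathbb P(V_j)\to\mathbb P(\mathfrak h)$ is the unique regular map on $\mathbb P(V_j)$ with $\psi_j(\ell)=\varphi^{-1}\big(\varphi(\mathfrak h)\cap\Sigma^0_{j,\ell}\big)$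 for generic $\ell$. Its degree $\deg\psi_j$ is the integer $d$ with $\psi_j^*\mathcal O_{\mathfrak h}(1)\cong\mathcal O_{V_j}(d)$, i.e. the common degree of homogeneous polynomials without common zeros on $\mathbb P(V_j)$ that define $\psi_j$. The curve $\psi_j$ is called decomposable if the number of indices $i\in\{1,\dots,m\}$ with $\operatorname{Im}\psi_i=\operatorname{Im}\psi_j$ equals $\deg\psi_j$. **Theorem.** For every $j\in\{1,\dots,m\}$, the curve $\psi_j$ is decomposable if and only if there exist a set $S\subset\{1,\dots,m\}$ of cardinality $\deg\psi_j$, a 1-dimensional subspace $\Gamma_j\subset\bigotimes_{r\notin S}V_r^*$ and, for each $r\in S$, an invertible projective transformation $g_r:\mathbb P(V_j^*)\to\mathbb P(V_r^*)$ such that, for all $\ell\in\mathbb P(V_j)$, the 1-dimensional space $\varphi\circ\psi_j(\ell)$ has $g_r\ell^0$ in the $r$-th slot for every $r\in S$ and $\Gamma_j$ in the remaining slots, i.e. up to the permutation of slots $$\varphi\circ\psi_j(\ell)=\Big(\bigotimes_{r\in S}g_r\ell^0\Big)\otimes\Gamma_j .$$ Moreover, for all such $S$, $\Gamma_j$, $(g_r)_{r\in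 S}$ one has $j\in S$ and $g_j=\mathrm{id}_{\mathbb P(V_j^*)}$. -/

import Mathlib

open Module
open scoped TensorProduct LinearAlgebra.Projectivization

section ProjectiveGeometry

variable {V W : Type*} [AddCommGroup V] [Module ℂ V] [AddCommGroup W] [Module ℂ W]

/-- Zariski open subsets of the projective space `ℙ(V)`: with respect to some linear coordinates,
the complement of `U` is the common zero locus of a set `I` of homogeneous polynomials. -/
def IsZariskiOpen (U : Set (ℙ ℂ V)) : Prop :=
  ∃ (n : ℕ) (x : Basis (Fin n) ℂ V) (I : Set (MvPolynomial (Fin n) ℂ)),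
    (∀ p ∈ I, ∃ d : ℕ, p.IsHomogeneous d) ∧
    ∀ (v : V) (hv : v ≠ 0),
      Projectivization.mk ℂ v hv ∈ U ↔ ∃ p ∈ I, MvPolynomial.eval (x.repr v) p ≠ 0

/-- A condition holds at the generic point of `ℙ(V)` if it holds at each point of some non-empty
Zariski open subset. -/
def HoldsGenerically (P : ℙ ℂ V → Prop) : Prop :=
  ∃ U : Set (ℙ ℂ V), IsZariskiOpen U ∧ U.Nonempty ∧ ∀ ℓ ∈ U, P ℓ

/-- In linear coordinates on `V` and `W`, the map `f : ℙ(V) → ℙ(W)` is given by homogeneous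
polynomials of the same degree `d`, without common zeros on `ℙ(V)`. These polynomials are the
components of the section of `𝒪(d) ⊗ W` obtained by pulling back the tautological section of
`𝒪_W(1) ⊗ W`, so that `f^* 𝒪_W(1) ≅ 𝒪_V(d)`. -/
def IsRegularOfDegree (f : ℙ ℂ V → ℙ ℂ W) (d : ℕ) : Prop :=
  ∃ (n k : ℕ) (x : Basis (Fin n) ℂ V) (y : Basis (Fin k) ℂ W)
    (F : Fin k → MvPolynomial (Fin n) ℂ),
    (∀ i, (F i).IsHomogeneous d) ∧
    ∀ (v : V) (hv : v ≠ 0),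
      ∃ hw : ∑ i, MvPolynomial.eval (x.repr v) (F i) • y i ≠ 0,
        f (Projectivization.mk ℂ v hv) =
          Projectivization.mk ℂ (∑ i, MvPolynomial.eval (x.repr v) (F i) • y i) hw

/-- A regular map defined on all of the projective space `ℙ(V)`. -/
def IsRegularMap (f : ℙ ℂ V → ℙ ℂ W) : Prop :=
  ∃ d : ℕ, IsRegularOfDegree f d

/-- The degree of a regular map `f : ℙ(V) → ℙ(W)`, i.e. the (unique, as soon as `dim V ≥ 2`)
integer `d` with `f^* 𝒪_W(1) ≅ 𝒪_V(d)`. -/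
noncomputable def regularMapDegree (f : ℙ ℂ V → ℙ ℂ W) : ℕ :=
  sInf {d : ℕ | IsRegularOfDegree f d}

/-- Invertible projective transformations `ℙ(V) → ℙ(W)`: those induced by linear isomorphisms. -/
def IsProjectiveTransformation (g : ℙ ℂ V → ℙ ℂ W) : Prop :=
  ∃ e : V ≃ₗ[ℂ] W, g = Projectivization.map e.toLinearMap e.injective

theorem finrank_dualAnnihilator_line (hV : finrank ℂ V = 2) (ℓ : ℙ ℂ V) :
    finrank ℂ ℓ.submodule.dualAnnihilator = 1 := by
  have : FiniteDimensional ℂ V := finite_of_finrank_pos (by omega)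
  have h1 := Subspace.finrank_add_finrank_dualAnnihilator_eq ℓ.submodule
  have h2 := ℓ.finrank_submodule
  omega

/-- The annihilator `ℓ⁰ ∈ ℙ(V^*)` of a point `ℓ ∈ ℙ(V)`, for a 2-dimensional space `V`. -/
noncomputable def annihilatorPoint (hV : finrank ℂ V = 2) (ℓ : ℙ ℂ V) : ℙ ℂ (Dual ℂ V) :=
  Projectivization.mk'' ℓ.submodule.dualAnnihilator (finrank_dualAnnihilator_line hV ℓ)

end ProjectiveGeometry

section Slots

variable {m : ℕ} (V : Fin m → Type*) [∀ r, AddCommGroup (V r)] [∀ r, Module ℂ (V r)]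

/-- The space `V_1^* ⊗ ⋯ ⊗ V_m^*`, which is canonically the dual of `V_1 ⊗ ⋯ ⊗ V_m` through
`PiTensorProduct.dualDistrib`. -/
abbrev TensorDual : Type _ := ⨂[ℂ] r, Dual ℂ (V r)

variable {V}

/-- `Σ_{j,ℓ} = V_1 ⊗ ⋯ ⊗ V_{j-1} ⊗ ℓ ⊗ V_{j+1} ⊗ ⋯ ⊗ V_m`, as a subspace of `V_1 ⊗ ⋯ ⊗ V_m`. -/
def slotSubspace (j : Fin m) (ℓ : ℙ ℂ (V j)) : Submodule ℂ (⨂[ℂ] r, V r) :=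
  Submodule.span ℂ {t | ∃ v : (r : Fin m) → V r, v j ∈ ℓ.submodule ∧
    t = PiTensorProduct.tprod ℂ v}

/-- The annihilator `Σ⁰_{j,ℓ}` of `Σ_{j,ℓ}` in `V_1^* ⊗ ⋯ ⊗ V_m^*`. -/
noncomputable def slotAnnihilator (j : Fin m) (ℓ : ℙ ℂ (V j)) : Submodule ℂ (TensorDual V) :=
  (slotSubspace j ℓ).dualAnnihilator.comap PiTensorProduct.dualDistrib

variable (V)

/-- The canonical isomorphism `(⨂_{r ∈ S} V_r^*) ⊗ (⨂_{r ∉ S} V_r^*) ≃ V_1^* ⊗ ⋯ ⊗ V_m^*` putting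
every factor into its own slot. -/
noncomputable def joinSlots (S : Finset (Fin m)) :
    (⨂[ℂ] r : {r : Fin m // r ∈ S}, Dual ℂ (V r)) ⊗[ℂ]
      (⨂[ℂ] r : {r : Fin m // r ∉ S}, Dual ℂ (V r)) ≃ₗ[ℂ] TensorDual V :=
  (PiTensorProduct.tmulEquivDep ℂ
      (fun i => Dual ℂ (V (Equiv.sumCompl (fun r : Fin m => r ∈ S) i)))).trans
    (PiTensorProduct.reindex ℂ (fun r => Dual ℂ (V r))
      (Equiv.sumCompl (fun r : Fin m => r ∈ S)).symm).symm

theorem joinSlots_tprod (S : Finset (Fin m)) (a : (r : Fin m) → Dual ℂ (V r)) :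
    joinSlots V S
      (PiTensorProduct.tprod ℂ (fun r : {r : Fin m // r ∈ S} => a r) ⊗ₜ[ℂ]
        PiTensorProduct.tprod ℂ (fun r : {r : Fin m // r ∉ S} => a r)) =
      PiTensorProduct.tprod ℂ a := by
  refine (LinearEquiv.symm_apply_eq _).2 ?_
  refine (PiTensorProduct.tmulEquivDep_apply ℂ
    (fun i => Dual ℂ (V (Equiv.sumCompl (fun r : Fin m => r ∈ S) i)))
    (fun r => a r) (fun r => a r)).trans ?_
  refine Eq.trans ?_ (PiTensorProduct.reindex_tprod (R := ℂ) (s := fun r => Dual ℂ (V r))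
    (Equiv.sumCompl (fun r : Fin m => r ∈ S)).symm a).symm
  congr 1
  funext i
  rcases i with i | i <;> rfl

variable {V}

/-- The subspace of `V_1^* ⊗ ⋯ ⊗ V_m^*` having the line `L r` in the `r`-th slot for each `r ∈ S`
and the line `Γ` in the remaining slots. -/
noncomputable def productLine (S : Finset (Fin m))
    (L : (r : {r : Fin m // r ∈ S}) → ℙ ℂ (Dual ℂ (V r)))
    (Γ : ℙ ℂ (⨂[ℂ] r : {r : Fin m // r ∉ S}, Dual ℂ (V r))) : Submodule ℂ (TensorDual V) :=
  Submodule.span ℂ {t | ∃ (a : (r : {r : Fin m // r ∈ S}) → Dual ℂ (V r))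
    (γ : ⨂[ℂ] r : {r : Fin m // r ∉ S}, Dual ℂ (V r)),
    (∀ r, a r ∈ (L r).submodule) ∧ γ ∈ Γ.submodule ∧
    t = joinSlots V S (PiTensorProduct.tprod ℂ a ⊗ₜ[ℂ] γ)}

end Slots

/-- A complex factorization structure of dimension `m`: an injective linear map `φ` of a complex
`(m+1)`-dimensional vector space `𝔥` into `V_1^* ⊗ ⋯ ⊗ V_m^*`, where the `V_r` are 2-dimensional,
such that `dim (φ(𝔥) ∩ Σ⁰_{j,ℓ}) = 1` for all `j` and generic `ℓ ∈ ℙ(V_j)`. -/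
structure FactorizationStructure {m : ℕ} (V : Fin m → Type*) [∀ r, AddCommGroup (V r)]
    [∀ r, Module ℂ (V r)] (𝔥 : Type*) [AddCommGroup 𝔥] [Module ℂ 𝔥] where
  toLinearMap : 𝔥 →ₗ[ℂ] TensorDual V
  finrank_slot : ∀ r, finrank ℂ (V r) = 2
  finrank_source : finrank ℂ 𝔥 = m + 1
  injective : Function.Injective toLinearMap
  generic_finrank : ∀ j : Fin m, HoldsGenerically fun ℓ : ℙ ℂ (V j) =>
    finrank ℂ ↥(LinearMap.range toLinearMap ⊓ slotAnnihilator j ℓ) = 1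

namespace FactorizationStructure

variable {m : ℕ} {V : Fin m → Type*} [∀ r, AddCommGroup (V r)] [∀ r, Module ℂ (V r)]
  {𝔥 : Type*} [AddCommGroup 𝔥] [Module ℂ 𝔥] (φ : FactorizationStructure V 𝔥)

/-- `ψ : ℙ(V_j) → ℙ(𝔥)` is a regular map, defined everywhere, that extends the generically defined
curve `ℓ ↦ φ⁻¹(φ(𝔥) ∩ Σ⁰_{j,ℓ})`. -/
def IsCurveExtension (j : Fin m) (ψ : ℙ ℂ (V j) → ℙ ℂ 𝔥) : Prop :=
  IsRegularMap ψ ∧ HoldsGenerically fun ℓ : ℙ ℂ (V j) =>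
    (ψ ℓ).submodule =
      (LinearMap.range φ.toLinearMap ⊓ slotAnnihilator j ℓ).comap φ.toLinearMap

theorem nonempty_projectivization (φ : FactorizationStructure V 𝔥) : Nonempty (ℙ ℂ 𝔥) := by
  have : Nontrivial 𝔥 :=
    nontrivial_of_finrank_pos (R := ℂ) (by rw [φ.finrank_source]; omega)
  infer_instance

/-- The factorization curve `ψ_j : ℙ(V_j) → ℙ(𝔥)`, the (existing and unique) regular map on `ℙ(V_j)`
that extends the generically defined curve `ℓ ↦ φ⁻¹(φ(𝔥) ∩ Σ⁰_{j,ℓ})`. -/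
noncomputable def curve (j : Fin m) : ℙ ℂ (V j) → ℙ ℂ 𝔥 :=
  haveI : Nonempty (ℙ ℂ 𝔥) := φ.nonempty_projectivization
  Classical.epsilon (φ.IsCurveExtension j)

/-- The degree of the factorization curve `ψ_j`. -/
noncomputable def curveDegree (j : Fin m) : ℕ :=
  regularMapDegree (φ.curve j)

/-- The factorization curves `ψ_i` and `ψ_j` are equivalent if they have the same image. -/
def CurvesEquivalent (i j : Fin m) : Prop :=
  Set.range (φ.curve i) = Set.range (φ.curve j)

/-- The factorization curve `ψ_j` is decomposable if its equivalence class among `ψ_1, …, ψ_m` has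
cardinality `deg ψ_j`. -/
def IsDecomposableCurve (j : Fin m) : Prop :=
  {i : Fin m | φ.CurvesEquivalent i j}.ncard = φ.curveDegree j

/-- `S` has cardinality `deg ψ_j`, each `g r` with `r ∈ S` is an invertible projective
transformation `ℙ(V_j^*) → ℙ(V_r^*)`, and for all `ℓ ∈ ℙ(V_j)` the 1-dimensional space `φ ∘ ψ_j(ℓ)`
has `g r ℓ⁰` in the `r`-th slot for each `r ∈ S`, and `Γ` elsewhere. -/
def IsSlotForm (j : Fin m) (S : Finset (Fin m))
    (Γ : ℙ ℂ (⨂[ℂ] r : {r : Fin m // r ∉ S}, Dual ℂ (V r)))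
    (g : (r : {r : Fin m // r ∈ S}) → ℙ ℂ (Dual ℂ (V j)) → ℙ ℂ (Dual ℂ (V r))) : Prop :=
  S.card = φ.curveDegree j ∧
  (∀ r, IsProjectiveTransformation (g r)) ∧
  ∀ ℓ : ℙ ℂ (V j), (φ.curve j ℓ).submodule.map φ.toLinearMap =
    productLine S (fun r => g r (annihilatorPoint (φ.finrank_slot j) ℓ)) Γ

end FactorizationStructure

/-!
# Decomposable factorization curves

An element of `V_1^* ⊗ ⋯ ⊗ V_m^*` is treated as a multilinear form (`tensorForm`); it lies in
`Σ⁰_{j,ℓ}` if and only if the form vanishes when a vector of `ℓ` is inserted in slot `j`. Points of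
`ℙ(V_j)` are studied along affine lines `v + t w`, where generic means all but finitely many `t`.

The curve `ψ_j` exists because the contractions in slot `j` form a linear pencil of matrices with
generically one-dimensional kernel: the kernel contains a polynomial vector, which after removal of
common factors and homogenization defines a regular map (`exists_isCurveExtension`). By continuity
`φ (ψ_j ℓ) ⊆ Σ⁰_{j,ℓ}` for all `ℓ`.

If `φ ∘ ψ_j` has the slot form with index set `S`, then for `r ∈ S` the line `φ (ψ_j ℓ)` also lies
in `Σ⁰_{r,ℓ'}`, where `ℓ'` is the point of `ℙ(V_r)` with annihilator `g_r ℓ⁰`; so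
`ψ_j ℓ = ψ_r ℓ'` and the two images agree. Conversely, if `Im ψ_i = Im ψ_j` with `i ∉ S`, the
constant factor `Γ` would be annihilated by every vector in slot `i`. Hence `S` is exactly the class
of `j`, which contains `j`, and `|S| = deg ψ_j` says that `ψ_j` is decomposable. In slot `j` the
factor of `φ (ψ_j ℓ)` is `ℓ⁰`, so `g_j` is the identity.

For the other direction let `S` be the class of `j`, with `|S| = d = deg ψ_j`, and restrict `φ ∘
ψ_j` to an affine line, which gives a polynomial tensor `T(t)` of degree at most `d`. For each `i
∈ S` and each `t` the tensor `T(t)` lies in some `Σ⁰_{i,ℓ'}`, so its `2 × 2` minors with respect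
to slot `i` vanish, and a primitive polynomial vector splits off in every slot in `S`
(`exists_slots_factors`). None of these `d` factors is constant, since otherwise `ψ_j` would be
constant on the line, while it is injective (`exists_tensorForm_update_ne_zero`). Comparing
degrees, each of them has degree one and the remaining factor is constant
(`natDegree_slots_factors`), and a primitive vector of degree one is an isomorphism `V_j ≃ V_i^*`.
-/

/-! ### Tensors of linear forms as multilinear forms -/

section TensorForm

variable {ι : Type*} [Finite ι] {M : ι → Type*} [∀ i, AddCommGroup (M i)] [∀ i, Module ℂ (M i)]

/-- The multilinear form on `∏ M_i` defined by an element of `⨂ M_i^*`. -/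
noncomputable def tensorForm : (⨂[ℂ] i, Dual ℂ (M i)) →ₗ[ℂ] MultilinearMap ℂ M ℂ :=
  (PiTensorProduct.lift (R := ℂ) (s := M) (E := ℂ)).symm.toLinearMap ∘ₗ
    PiTensorProduct.dualDistrib

theorem tensorForm_apply (T : ⨂[ℂ] i, Dual ℂ (M i)) (u : ∀ i, M i) :
    tensorForm T u = PiTensorProduct.dualDistrib T (PiTensorProduct.tprod ℂ u) := rfl

theorem tensorForm_tprod [Fintype ι] (a : ∀ i, Dual ℂ (M i)) (u : ∀ i, M i) :
    tensorForm (PiTensorProduct.tprod ℂ a) u = ∏ i, a i (u i) := by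
  rw [tensorForm_apply, PiTensorProduct.dualDistrib_apply]

theorem tensorForm_bijective [∀ i, FiniteDimensional ℂ (M i)] :
    Function.Bijective (tensorForm (M := M)) :=
  (PiTensorProduct.lift (R := ℂ) (s := M) (E := ℂ)).symm.bijective.comp
    (PiTensorProduct.dualDistribEquiv (R := ℂ) (M := M)).bijective

theorem tensorForm_ext_basis {κ : ι → Type*} [∀ i, FiniteDimensional ℂ (M i)]
    (b : ∀ i, Basis (κ i) ℂ (M i)) {S T : ⨂[ℂ] i, Dual ℂ (M i)}
    (h : ∀ σ : ∀ i, κ i, tensorForm S (fun i => b i (σ i)) = tensorForm T (fun i => b i (σ i))) :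
    S = T := by
  refine tensorForm_bijective.1 ?_
  exact Basis.ext_multilinear b h

theorem exists_tensorForm_basis_eq {κ : ι → Type*} [∀ i, FiniteDimensional ℂ (M i)]
    (b : ∀ i, Basis (κ i) ℂ (M i)) (c : (∀ i, κ i) → ℂ) :
    ∃ T : ⨂[ℂ] i, Dual ℂ (M i), ∀ σ, tensorForm T (fun i => b i (σ i)) = c σ := by
  obtain ⟨T, hT⟩ := (PiTensorProduct.dualDistribEquiv (R := ℂ) (M := M)).surjective
    ((Basis.piTensorProduct b).constr ℂ c)
  refine ⟨T, fun σ => ?_⟩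
  have := LinearMap.congr_fun hT (Basis.piTensorProduct b σ)
  rw [Basis.constr_basis, Basis.piTensorProduct_apply] at this
  exact this

end TensorForm

section JoinSlots

variable {m : ℕ} {V : Fin m → Type*} [∀ r, AddCommGroup (V r)] [∀ r, Module ℂ (V r)]

theorem tensorForm_joinSlots (S : Finset (Fin m))
    (a : (r : {r : Fin m // r ∈ S}) → Dual ℂ (V r))
    (γ : ⨂[ℂ] r : {r : Fin m // r ∉ S}, Dual ℂ (V r)) (u : ∀ r, V r) :
    tensorForm (joinSlots V S (PiTensorProduct.tprod ℂ a ⊗ₜ[ℂ] γ)) u =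
      (∏ r, a r (u r)) * tensorForm γ (fun r => u r) := by
  classical
  induction γ using PiTensorProduct.induction_on with
  | smul_tprod c b =>
    let e : (r : Fin m) → Dual ℂ (V r) := fun r => if h : r ∈ S then a ⟨r, h⟩ else b ⟨r, h⟩
    have ha : a = fun r : {r : Fin m // r ∈ S} => e r := by
      funext r
      simp [e, r.2]
    have hb : b = fun r : {r : Fin m // r ∉ S} => e r := by
      funext r
      simp [e, r.2]
    rw [TensorProduct.tmul_smul, map_smul, map_smul, map_smul, smul_apply,
      smul_apply, tensorForm_tprod, smul_eq_mul, smul_eq_mul, ha, hb,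
      joinSlots_tprod, tensorForm_tprod, mul_left_comm,
      ← Fintype.prod_subtype_mul_prod_subtype (fun r => r ∈ S) (fun r => e r (u r))]
    congr!
  | add x y hx hy =>
    rw [TensorProduct.tmul_add, map_add, map_add, map_add, add_apply,
      add_apply, hx, hy, mul_add]

theorem productLine_mk (S : Finset (Fin m))
    (a : (r : {r : Fin m // r ∈ S}) → Dual ℂ (V r)) (ha : ∀ r, a r ≠ 0)
    (γ : ⨂[ℂ] r : {r : Fin m // r ∉ S}, Dual ℂ (V r)) (hγ : γ ≠ 0) :
    productLine S (fun r => Projectivization.mk ℂ (a r) (ha r)) (Projectivization.mk ℂ γ hγ) =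
      Submodule.span ℂ {joinSlots V S (PiTensorProduct.tprod ℂ a ⊗ₜ[ℂ] γ)} := by
  classical
  refine le_antisymm (Submodule.span_le.2 ?_) (Submodule.span_mono ?_)
  · rintro t ⟨b, δ, hb, hδ, rfl⟩
    simp only [Projectivization.submodule_mk, Submodule.mem_span_singleton] at hb hδ
    choose c hc using hb
    obtain ⟨k, rfl⟩ := hδ
    obtain rfl : (fun r => c r • a r) = b := funext hc
    rw [MultilinearMap.map_smul_univ, TensorProduct.smul_tmul_smul, map_smul]
    exact Submodule.smul_mem _ _ (Submodule.mem_span_singleton_self _)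
  · rintro _ rfl
    exact ⟨a, γ, fun r => Submodule.mem_span_singleton_self _,
      Submodule.mem_span_singleton_self _, rfl⟩

theorem mem_slotAnnihilator_mk {j : Fin m} {v : V j} (hv : v ≠ 0) {T : TensorDual V} :
    T ∈ slotAnnihilator j (Projectivization.mk ℂ v hv) ↔
      ∀ u, tensorForm T (Function.update u j v) = 0 := by
  have : T ∈ slotAnnihilator j (Projectivization.mk ℂ v hv) ↔
      ∀ u : ∀ r, V r, u j ∈ ℂ ∙ v → tensorForm T u = 0 := by
    rw [slotAnnihilator, Submodule.mem_comap, Submodule.mem_dualAnnihilator]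
    constructor
    · intro h u hu
      exact h _ (Submodule.subset_span ⟨u, hu, rfl⟩)
    · intro h w hw
      rw [slotSubspace] at hw
      induction hw using Submodule.span_induction with
      | mem x hx =>
        obtain ⟨u, hu, rfl⟩ := hx
        exact h u hu
      | zero => exact map_zero _
      | add x y _ _ hx hy => rw [map_add, hx, hy, add_zero]
      | smul c x _ hx => rw [map_smul, hx, smul_zero]
  rw [this]
  constructor
  · intro h u
    refine h _ ?_
    rw [Function.update_self]
    exact Submodule.mem_span_singleton_self _
  · intro h u hu
    obtain ⟨c, hc⟩ := Submodule.mem_span_singleton.1 hu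
    rw [← Function.update_eq_self j u, ← hc, MultilinearMap.map_update_smul, h, smul_zero]

theorem exists_apply_ne_zero {ι : Type*} {M : ι → Type*} [∀ i, AddCommGroup (M i)]
    [∀ i, Module ℂ (M i)] {a : ∀ i, Dual ℂ (M i)} (ha : ∀ i, a i ≠ 0) :
    ∃ z : ∀ i, M i, ∀ i, a i (z i) ≠ 0 := by
  have h (i : ι) : ∃ z, a i z ≠ 0 := by
    by_contra! h0
    exact ha i (LinearMap.ext h0)
  choose z hz using h
  exact ⟨z, hz⟩

theorem exists_tensorForm_ne_zero {ι : Type*} [Finite ι] {M : ι → Type*}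
    [∀ i, AddCommGroup (M i)] [∀ i, Module ℂ (M i)] [∀ i, FiniteDimensional ℂ (M i)]
    {T : ⨂[ℂ] i, Dual ℂ (M i)} (hT : T ≠ 0) : ∃ u, tensorForm T u ≠ 0 := by
  by_contra! h
  refine hT (tensorForm_bijective.1 ?_)
  rw [map_zero]
  exact MultilinearMap.ext h

theorem joinSlots_tprod_ne_zero [∀ r, FiniteDimensional ℂ (V r)] (S : Finset (Fin m))
    {a : (r : {r : Fin m // r ∈ S}) → Dual ℂ (V r)}
    {γ : ⨂[ℂ] r : {r : Fin m // r ∉ S}, Dual ℂ (V r)} (ha : ∀ r, a r ≠ 0) (hγ : γ ≠ 0) :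
    joinSlots V S (PiTensorProduct.tprod ℂ a ⊗ₜ[ℂ] γ) ≠ 0 := by
  obtain ⟨z, hz⟩ := exists_apply_ne_zero ha
  obtain ⟨u, hu⟩ := exists_tensorForm_ne_zero hγ
  intro h0
  have := tensorForm_joinSlots S a γ (fun r => if h : r ∈ S then z ⟨r, h⟩ else u ⟨r, h⟩)
  rw [h0, map_zero, zero_apply] at this
  refine mul_ne_zero (Finset.prod_ne_zero_iff.2 fun r _ => ?_) ?_ this.symm
  · simpa [r.2] using hz r
  · convert hu using 2
    funext r
    simp [r.2]

/-- If a product tensor is annihilated by `v` in a slot `j ∈ S`, so is its factor in slot `j`. -/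
theorem apply_eq_zero_of_joinSlots_mem [∀ r, FiniteDimensional ℂ (V r)] {S : Finset (Fin m)}
    {a : (r : {r : Fin m // r ∈ S}) → Dual ℂ (V r)}
    {γ : ⨂[ℂ] r : {r : Fin m // r ∉ S}, Dual ℂ (V r)} (ha : ∀ r, a r ≠ 0) (hγ : γ ≠ 0)
    {j : Fin m} (hj : j ∈ S) {v : V j} (hv : v ≠ 0)
    (h : joinSlots V S (PiTensorProduct.tprod ℂ a ⊗ₜ[ℂ] γ) ∈
      slotAnnihilator j (Projectivization.mk ℂ v hv)) : a ⟨j, hj⟩ v = 0 := by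
  by_contra hne
  obtain ⟨z, hz⟩ := exists_apply_ne_zero ha
  obtain ⟨u, hu⟩ := exists_tensorForm_ne_zero hγ
  have h4 := (mem_slotAnnihilator_mk hv).1 h
    (fun r => if h : r ∈ S then z ⟨r, h⟩ else u ⟨r, h⟩)
  rw [tensorForm_joinSlots] at h4
  refine mul_ne_zero (Finset.prod_ne_zero_iff.2 fun r _ => ?_) ?_ h4
  · by_cases hr : (r : Fin m) = j
    · obtain ⟨r, hr'⟩ := r
      obtain rfl : r = j := hr
      rw [Function.update_self]
      exact hne
    · rw [Function.update_of_ne hr]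
      simpa [r.2] using hz r
  · convert hu using 2
    funext r
    have hr : (r : Fin m) ≠ j := fun h => r.2 (h ▸ hj)
    rw [Function.update_of_ne hr]
    simp [r.2]

/-- If a product tensor is annihilated by `v` in a slot `i ∉ S`, so is its factor `γ`. -/
theorem tensorForm_update_eq_zero_of_joinSlots_mem {S : Finset (Fin m)}
    {a : (r : {r : Fin m // r ∈ S}) → Dual ℂ (V r)}
    {γ : ⨂[ℂ] r : {r : Fin m // r ∉ S}, Dual ℂ (V r)} (ha : ∀ r, a r ≠ 0)
    {i : Fin m} (hi : i ∉ S) {v : V i} (hv : v ≠ 0)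
    (h : joinSlots V S (PiTensorProduct.tprod ℂ a ⊗ₜ[ℂ] γ) ∈
      slotAnnihilator i (Projectivization.mk ℂ v hv))
    (u : ∀ r : {r : Fin m // r ∉ S}, V r) :
    tensorForm γ (Function.update u ⟨i, hi⟩ v) = 0 := by
  obtain ⟨z, hz⟩ := exists_apply_ne_zero ha
  have h4 := (mem_slotAnnihilator_mk hv).1 h
    (fun r => if h : r ∈ S then z ⟨r, h⟩ else u ⟨r, h⟩)
  rw [tensorForm_joinSlots] at h4
  refine Eq.trans (congr_arg _ (funext fun r => ?_)) ((mul_eq_zero.1 h4).resolve_left ?_)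
  · by_cases hr : r = ⟨i, hi⟩
    · subst hr
      rw [Function.update_self, Function.update_self]
    · have hr' : (r : Fin m) ≠ i := fun h => hr (Subtype.ext h)
      rw [Function.update_of_ne hr, Function.update_of_ne hr']
      simp [r.2]
  · refine Finset.prod_ne_zero_iff.2 fun r _ => ?_
    have hr' : (r : Fin m) ≠ i := fun h => hi (h ▸ r.2)
    rw [Function.update_of_ne hr']
    simpa [r.2] using hz r

/-- A tensor whose contraction in slot `j` with each of two independent vectors vanishes is zero,
because `dim V_j = 2`. -/
theorem eq_zero_of_slot_eq_zero {ι : Type*} [Finite ι] [DecidableEq ι] {M : ι → Type*}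
    [∀ i, AddCommGroup (M i)] [∀ i, Module ℂ (M i)] [∀ i, FiniteDimensional ℂ (M i)] {j : ι}
    (hj : finrank ℂ (M j) = 2) {v w : M j} (hvw : LinearIndependent ℂ ![v, w])
    {T : ⨂[ℂ] i, Dual ℂ (M i)} (hv : ∀ u, tensorForm T (Function.update u j v) = 0)
    (hw : ∀ u, tensorForm T (Function.update u j w) = 0) : T = 0 := by
  refine tensorForm_bijective.1 ?_
  rw [map_zero]
  refine MultilinearMap.ext fun u => ?_
  have hspan := hvw.span_eq_top_of_card_eq_finrank' (by simp [hj])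
  have hu : u j ∈ Submodule.span ℂ (Set.range ![v, w]) := hspan ▸ Submodule.mem_top
  rw [Matrix.range_cons, Matrix.range_cons, Matrix.range_empty, Set.union_empty,
    Set.singleton_union, Submodule.mem_span_pair] at hu
  obtain ⟨a, b, hab⟩ := hu
  rw [← Function.update_eq_self j u, ← hab, MultilinearMap.map_update_add,
    MultilinearMap.map_update_smul, MultilinearMap.map_update_smul, hv, hw]
  simp

end JoinSlots

section Proportional

variable {W : Type*} [AddCommGroup W] [Module ℂ W]

/-- Proportionality can be tested on the `2 × 2` minors with respect to a separating family of
functionals. This makes it a closed condition on curves of vectors. -/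
theorem mem_span_singleton_of_minors {ι : Type*} (c : ι → W →ₗ[ℂ] ℂ)
    (hc : ∀ x, (∀ i, c i x = 0) → x = 0) {a b : W} (ha : a ≠ 0)
    (h : ∀ i k, c i a * c k b = c k a * c i b) : b ∈ ℂ ∙ a := by
  obtain ⟨i, hi⟩ : ∃ i, c i a ≠ 0 := by
    by_contra! h0
    exact ha (hc a h0)
  refine Submodule.mem_span_singleton.2 ⟨c i b / c i a, sub_eq_zero.1 (hc _ fun k => ?_)⟩
  rw [map_sub, map_smul, smul_eq_mul, sub_eq_zero, div_mul_eq_mul_div, div_eq_iff hi]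
  linear_combination h k i

theorem minors_of_mem_span_singleton {ι : Type*} (c : ι → W →ₗ[ℂ] ℂ) {a b : W} (h : b ∈ ℂ ∙ a)
    (i k : ι) : c i a * c k b = c k a * c i b := by
  obtain ⟨s, rfl⟩ := Submodule.mem_span_singleton.1 h
  simp only [map_smul, smul_eq_mul]
  ring

end Proportional

/-! ### Generic points and regular maps on affine lines -/

section Lines

open Filter

theorem eq_of_eventually_cofinite_eq {f g : ℂ → ℂ} (hf : Continuous f) (hg : Continuous g)
    (h : ∀ᶠ t in cofinite, f t = g t) (t : ℂ) : f t = g t := by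
  have hd : Dense {t | f t = g t} := by
    have := (mem_cofinite.1 h).countable.dense_compl ℂ
    rwa [compl_compl] at this
  exact congr_fun (Continuous.ext_on hd hf hg fun t ht => ht) t

variable {V W : Type*} [AddCommGroup V] [Module ℂ V] [AddCommGroup W] [Module ℂ W]

theorem add_smul_ne_zero {v w : V} (h : LinearIndependent ℂ ![v, w]) (t : ℂ) : v + t • w ≠ 0 := by
  intro h0
  have := LinearIndependent.pair_iff.1 h 1 t (by rwa [one_smul])
  exact one_ne_zero this.1

theorem linearIndependent_pair_map (e : V ≃ₗ[ℂ] W) {v w : V} (h : LinearIndependent ℂ ![v, w]) :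
    LinearIndependent ℂ ![e v, e w] := by
  refine LinearIndependent.pair_iff.2 fun a b hab => LinearIndependent.pair_iff.1 h a b ?_
  rwa [← map_smul, ← map_smul, ← map_add, e.map_eq_zero_iff] at hab

theorem linearIndependent_basis_pair (x : Basis (Fin 2) ℂ V) :
    LinearIndependent ℂ ![x 0, x 1] := by
  have h := x.linearIndependent
  rwa [show ⇑x = ![x 0, x 1] from funext fun i => by fin_cases i <;> rfl] at h

theorem exists_linearIndependent_pair (hV : finrank ℂ V = 2) {v : V} (hv : v ≠ 0) :
    ∃ w, LinearIndependent ℂ ![v, w] := by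
  have : FiniteDimensional ℂ V := finite_of_finrank_pos (by omega)
  exact exists_linearIndependent_pair_of_one_lt_finrank (by omega) hv

theorem exists_eq_add_of_pair (hV : finrank ℂ V = 2) {v w : V}
    (h : LinearIndependent ℂ ![v, w]) (u : V) : ∃ a b : ℂ, u = a • v + b • w := by
  have : FiniteDimensional ℂ V := finite_of_finrank_pos (by omega)
  have hspan := h.span_eq_top_of_card_eq_finrank' (by simp [hV])
  have hu : u ∈ Submodule.span ℂ (Set.range ![v, w]) := hspan ▸ Submodule.mem_top
  rw [Matrix.range_cons, Matrix.range_cons, Matrix.range_empty, Set.union_empty,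
    Set.singleton_union, Submodule.mem_span_pair] at hu
  obtain ⟨a, b, hab⟩ := hu
  exact ⟨a, b, hab.symm⟩

theorem exists_polynomial_eval_line {n d : ℕ} {p : MvPolynomial (Fin n) ℂ}
    (hp : p.IsHomogeneous d) (a b : Fin n → ℂ) :
    ∃ q : Polynomial ℂ, q.natDegree ≤ d ∧
      ∀ t, q.eval t = MvPolynomial.eval (a + t • b) p := by
  refine ⟨MvPolynomial.aeval (fun i => Polynomial.C (a i) + Polynomial.C (b i) * Polynomial.X) p,
    ?_, fun t => ?_⟩
  · rw [MvPolynomial.aeval_def, MvPolynomial.eval₂_eq]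
    refine Polynomial.natDegree_sum_le_of_forall_le _ _ fun e he => ?_
    refine (Polynomial.natDegree_C_mul_le _ _).trans ?_
    refine (Polynomial.natDegree_prod_le _ _).trans ?_
    rw [← hp (MvPolynomial.mem_support_iff.1 he), Finsupp.weight_apply, Finsupp.sum]
    refine Finset.sum_le_sum fun i _ => ?_
    refine Polynomial.natDegree_pow_le.trans ?_
    rw [Pi.one_apply, smul_eq_mul]
    refine Nat.mul_le_mul_left _ ?_
    compute_degree
  · rw [← Polynomial.coe_evalRingHom, MvPolynomial.aeval_def, MvPolynomial.hom_eval₂]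
    have : (Polynomial.evalRingHom t).comp (algebraMap ℂ (Polynomial ℂ)) = RingHom.id ℂ := by
      ext; simp
    rw [this, MvPolynomial.eval₂_id]
    congr 2
    funext i
    simp only [Polynomial.coe_evalRingHom, Polynomial.eval_add,
      Polynomial.eval_C, Polynomial.eval_mul, Polynomial.eval_X, Pi.add_apply, Pi.smul_apply,
      smul_eq_mul, mul_comm]

theorem eval_smul_of_isHomogeneous {n d : ℕ} {p : MvPolynomial (Fin n) ℂ}
    (hp : p.IsHomogeneous d) (c : ℂ) (a : Fin n → ℂ) :
    MvPolynomial.eval (c • a) p = c ^ d * MvPolynomial.eval a p := by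
  rw [MvPolynomial.eval_eq, MvPolynomial.eval_eq, Finset.mul_sum]
  refine Finset.sum_congr rfl fun e he => ?_
  simp only [Pi.smul_apply, smul_eq_mul, mul_pow, Finset.prod_mul_distrib]
  rw [Finset.prod_pow_eq_pow_sum, ← hp (MvPolynomial.mem_support_iff.1 he), Finsupp.weight_apply,
    Finsupp.sum]
  simp only [Pi.one_apply, smul_eq_mul, mul_one]
  ring

/-- A property that holds generically on a projective line holds at all but finitely many points
of each affine line. -/
theorem HoldsGenerically.eventually_line {P : ℙ ℂ V → Prop} (hP : HoldsGenerically P)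
    (hV : finrank ℂ V = 2) {v w : V} (hvw : LinearIndependent ℂ ![v, w]) :
    ∀ᶠ t : ℂ in cofinite, ∀ h : v + t • w ≠ 0, P (Projectivization.mk ℂ (v + t • w) h) := by
  obtain ⟨U, ⟨n, x, I, hI, hU⟩, ⟨ℓ, hℓ⟩, hUP⟩ := hP
  induction ℓ using Projectivization.ind with | h u hu =>
  obtain ⟨p, hpI, hpu⟩ := (hU u hu).1 hℓ
  obtain ⟨d, hd⟩ := hI p hpI
  obtain ⟨q, -, hq⟩ := exists_polynomial_eval_line hd (x.repr v) (x.repr w)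
  have hline (a b : V) (t : ℂ) : ⇑(x.repr (a + t • b)) =
      ⇑(x.repr a) + t • ⇑(x.repr b) := by
    funext i
    simp
  by_cases hq0 : q = 0
  · -- `p` vanishes on the affine line, hence on its cone and, by continuity, everywhere
    exfalso
    have hz (t : ℂ) : MvPolynomial.eval (x.repr (v + t • w)) p = 0 := by
      rw [hline, ← hq, hq0, Polynomial.eval_zero]
    obtain ⟨a, b, rfl⟩ := exists_eq_add_of_pair hV hvw u
    have hz' {a b : ℂ} (ha : a ≠ 0) : MvPolynomial.eval (x.repr (a • v + b • w)) p = 0 := by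
      have : a • v + b • w = a • (v + (b / a) • w) := by
        rw [smul_add, smul_smul, mul_div_cancel₀ _ ha]
      rw [this, map_smul, Finsupp.coe_smul, eval_smul_of_isHomogeneous hd, hz, mul_zero]
    have hc : Continuous fun s : ℂ => MvPolynomial.eval (x.repr (s • v + b • w)) p := by
      refine (MvPolynomial.continuous_eval p).comp (continuous_pi fun i => ?_)
      simp only [map_add, map_smul, Finsupp.coe_add, Finsupp.coe_smul, Pi.add_apply,
        Pi.smul_apply, smul_eq_mul]
      fun_prop
    refine hpu (eq_of_eventually_cofinite_eq hc continuous_const ?_ a)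
    filter_upwards [(Set.finite_singleton (0 : ℂ)).compl_mem_cofinite] with s hs
    exact hz' hs
  · have hfin : {t | q.IsRoot t}.Finite := Polynomial.finite_setOfPred_isRoot hq0
    filter_upwards [hfin.compl_mem_cofinite] with t ht h
    refine hUP _ ((hU _ h).2 ⟨p, hpI, ?_⟩)
    rw [hline, ← hq]
    exact ht

/-- Along an affine line, a regular map of degree `d` is given by a vector whose coordinates are
polynomials of degree at most `d` in the parameter. -/
theorem IsRegularOfDegree.exists_line {f : ℙ ℂ V → ℙ ℂ W} {d : ℕ} (hf : IsRegularOfDegree f d)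
    (v w : V) :
    ∃ F : ℂ → W, (∀ c : W →ₗ[ℂ] ℂ, ∃ q : Polynomial ℂ, q.natDegree ≤ d ∧
        ∀ t, c (F t) = q.eval t) ∧
      ∀ t (h : v + t • w ≠ 0), ∃ hF : F t ≠ 0,
        f (Projectivization.mk ℂ (v + t • w) h) = Projectivization.mk ℂ (F t) hF := by
  obtain ⟨n, k, x, y, P, hP, hf⟩ := hf
  refine ⟨fun t => ∑ i, MvPolynomial.eval (x.repr (v + t • w)) (P i) • y i, fun c => ?_,
    fun t h => hf _ h⟩
  choose q hqd hq using fun i => exists_polynomial_eval_line (hP i) (x.repr v) (x.repr w)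
  refine ⟨∑ i, q i * Polynomial.C (c (y i)), ?_, fun t => ?_⟩
  · exact Polynomial.natDegree_sum_le_of_forall_le _ _ fun i _ =>
      (Polynomial.natDegree_mul_C_le _ _).trans (hqd i)
  · simp [Polynomial.eval_finsetSum, hq]

theorem IsRegularMap.exists_line {f : ℙ ℂ V → ℙ ℂ W} (hf : IsRegularMap f) (v w : V) :
    ∃ F : ℂ → W, (∀ c : W →ₗ[ℂ] ℂ, Continuous fun t => c (F t)) ∧
      ∀ t (h : v + t • w ≠ 0), ∃ hF : F t ≠ 0,
        f (Projectivization.mk ℂ (v + t • w) h) = Projectivization.mk ℂ (F t) hF := by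
  obtain ⟨d, hd⟩ := hf
  obtain ⟨F, hF, h⟩ := hd.exists_line v w
  refine ⟨F, fun c => ?_, h⟩
  obtain ⟨q, -, hq⟩ := hF c
  simpa only [hq] using q.continuous

theorem mk_eq_mk_of_mem_span {a b : V} (ha : a ≠ 0) (hb : b ≠ 0) (h : b ∈ ℂ ∙ a) :
    Projectivization.mk ℂ a ha = Projectivization.mk ℂ b hb := by
  obtain ⟨c, hc⟩ := Submodule.mem_span_singleton.1 h
  exact ((Projectivization.mk_eq_mk_iff' ℂ b a hb ha).2 ⟨c, hc⟩).symm

theorem mem_span_of_mk_eq_mk {a b : V} {ha : a ≠ 0} {hb : b ≠ 0}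
    (h : Projectivization.mk ℂ a ha = Projectivization.mk ℂ b hb) : b ∈ ℂ ∙ a := by
  obtain ⟨c, hc⟩ := (Projectivization.mk_eq_mk_iff' ℂ b a hb ha).1 h.symm
  exact Submodule.mem_span_singleton.2 ⟨c, hc⟩

/-- Two regular maps on a projective line that agree, up to a change of coordinates, at almost all
points of an affine line agree at its origin. -/
theorem IsRegularMap.eq_of_eventually {V' : Type*} [AddCommGroup V'] [Module ℂ V']
    {f : ℙ ℂ V → ℙ ℂ W} {g : ℙ ℂ V' → ℙ ℂ W} (hf : IsRegularMap f) (hg : IsRegularMap g)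
    (e : V ≃ₗ[ℂ] V') {v w : V} (hvw : LinearIndependent ℂ ![v, w])
    (h : ∀ᶠ t : ℂ in cofinite, f (Projectivization.mk ℂ (v + t • w) (add_smul_ne_zero hvw t)) =
      g (Projectivization.mk ℂ (e (v + t • w))
        (e.map_ne_zero_iff.2 (add_smul_ne_zero hvw t)))) (hv : v ≠ 0) :
    f (Projectivization.mk ℂ v hv) =
      g (Projectivization.mk ℂ (e v) (e.map_ne_zero_iff.2 hv)) := by
  obtain ⟨F, hF, hF'⟩ := hf.exists_line v w
  obtain ⟨G, hG, hG'⟩ := hg.exists_line (e v) (e w)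
  have hG2 (t : ℂ) (h : e (v + t • w) ≠ 0) : ∃ hG : G t ≠ 0,
      g (Projectivization.mk ℂ (e (v + t • w)) h) = Projectivization.mk ℂ (G t) hG := by
    have he : e (v + t • w) = e v + t • e w := by simp
    obtain ⟨h1, h2⟩ := hG' t (he ▸ h)
    refine ⟨h1, ?_⟩
    rw [← h2]
    congr 1
    simp only [he]
  have hmin (c k : W →ₗ[ℂ] ℂ) (t : ℂ) : c (F t) * k (G t) = k (F t) * c (G t) := by
    refine eq_of_eventually_cofinite_eq ((hF c).mul (hG k)) ((hF k).mul (hG c)) ?_ t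
    filter_upwards [h] with t ht
    obtain ⟨h1, h2⟩ := hF' t (add_smul_ne_zero hvw t)
    obtain ⟨h3, h4⟩ := hG2 t (e.map_ne_zero_iff.2 (add_smul_ne_zero hvw t))
    rw [h2, h4] at ht
    exact minors_of_mem_span_singleton (fun c : W →ₗ[ℂ] ℂ => c) (mem_span_of_mk_eq_mk ht) c k
  have h0 : v + (0 : ℂ) • w = v := by simp
  obtain ⟨h1, h2⟩ := hF' 0 (by rwa [h0])
  obtain ⟨h3, h4⟩ := hG2 0 (by rw [h0]; exact e.map_ne_zero_iff.2 hv)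
  simp only [h0] at h2 h4
  rw [h2, h4]
  exact mk_eq_mk_of_mem_span _ _ (mem_span_singleton_of_minors (fun c : W →ₗ[ℂ] ℂ => c)
    (fun x hx => (Module.forall_dual_apply_eq_zero_iff ℂ x).1 hx) h1 fun c k => hmin c k 0)

end Lines

/-! ### Existence of the factorization curves -/

section PolynomialKernel

open Polynomial

/-- A polynomial matrix whose values have a nontrivial kernel at infinitely many points has a
nontrivial kernel over the polynomial ring: a left inverse over the fraction field would, after
clearing denominators, give left inverses of all but finitely many values. -/
theorem exists_polynomial_kernel {ι : Type*} [Finite ι] {n : ℕ} (M : Matrix ι (Fin n) ℂ[X])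
    (hM : {t : ℂ | ∃ x : Fin n → ℂ, x ≠ 0 ∧ ∀ i, ∑ k, (M i k).eval t * x k = 0}.Infinite) :
    ∃ f : Fin n → ℂ[X], f ≠ 0 ∧ ∀ i, ∑ k, M i k * f k = 0 := by
  classical
  have := Fintype.ofFinite ι
  let K := FractionRing ℂ[X]
  have hinj : Function.Injective (algebraMap ℂ[X] K) := IsFractionRing.injective _ _
  by_cases hker : LinearMap.ker (M.map (algebraMap ℂ[X] K)).mulVecLin = ⊥
  · exfalso
    obtain ⟨L, hL⟩ := LinearMap.exists_leftInverse_of_injective _ hker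
    obtain ⟨D, hD⟩ := IsLocalization.exist_integer_multiples_of_finite (nonZeroDivisors ℂ[X])
      (fun p : Fin n × ι => LinearMap.toMatrix' L p.1 p.2)
    choose N hN using hD
    have hLM : LinearMap.toMatrix' L * M.map (algebraMap ℂ[X] K) = 1 := by
      rw [← LinearMap.toMatrix'_id, ← hL, LinearMap.toMatrix'_comp]
      congr 1
      exact (LinearMap.toMatrix'_toLin' _).symm
    have hNM (k l : Fin n) : ∑ i, N (k, i) * M i l = if k = l then (D : ℂ[X]) else 0 := by
      apply hinj
      have h1 : ∑ i, LinearMap.toMatrix' L k i * algebraMap ℂ[X] K (M i l) =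
          if k = l then 1 else 0 := by
        have := congr_fun (congr_fun hLM k) l
        rwa [Matrix.mul_apply, Matrix.one_apply] at this
      have h2 := congr_arg (fun z => algebraMap ℂ[X] K D * z) h1
      rw [Finset.mul_sum] at h2
      rw [map_sum, apply_ite (algebraMap ℂ[X] K), map_zero]
      convert h2 using 1
      · refine Finset.sum_congr rfl fun i _ => ?_
        rw [map_mul, hN, Algebra.smul_def, mul_assoc]
      · split_ifs <;> simp
    refine hM ((Polynomial.finite_setOfPred_isRoot (nonZeroDivisors.ne_zero D.2)).subset ?_)
    rintro t ⟨x, hx, h0⟩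
    obtain ⟨k, hk⟩ := Function.ne_iff.1 hx
    by_contra hroot
    have hsum : ∑ i, (N (k, i)).eval t * ∑ l, (M i l).eval t * x l = (D : ℂ[X]).eval t * x k := by
      simp only [Finset.mul_sum, ← mul_assoc]
      rw [Finset.sum_comm]
      simp only [← Finset.sum_mul]
      have (l : Fin n) : ∑ i, (N (k, i)).eval t * (M i l).eval t =
          if k = l then (D : ℂ[X]).eval t else 0 := by
        rw [← eval_zero (x := t), ← apply_ite (eval t), ← hNM, eval_finsetSum]
        simp only [eval_mul]
      simp only [this]
      simp
    simp only [h0, mul_zero, Finset.sum_const_zero] at hsum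
    exact mul_ne_zero hroot hk hsum.symm
  · obtain ⟨g, hg, hg0⟩ := Submodule.exists_mem_ne_zero_of_ne_bot hker
    obtain ⟨D, hD⟩ := IsLocalization.exist_integer_multiples_of_finite (nonZeroDivisors ℂ[X]) g
    choose f hf using hD
    have hD0 : algebraMap ℂ[X] K D ≠ 0 := by
      rw [Ne, map_eq_zero_iff _ hinj]
      exact nonZeroDivisors.ne_zero D.2
    refine ⟨f, ?_, fun i => hinj ?_⟩
    · rintro rfl
      refine hg0 (funext fun k => ?_)
      have := hf k
      rw [Pi.zero_apply, map_zero, Algebra.smul_def] at this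
      exact (mul_eq_zero.1 this.symm).resolve_left hD0
    · have h1 : ∑ k, algebraMap ℂ[X] K (M i k) * g k = 0 := congr_fun hg i
      rw [map_sum, map_zero, ← mul_zero (algebraMap ℂ[X] K D), ← h1, Finset.mul_sum]
      refine Finset.sum_congr rfl fun k _ => ?_
      rw [map_mul, hf, Algebra.smul_def, mul_left_comm]

/-- Dividing a nonzero polynomial vector by the greatest common divisor of its entries removes their
common zeros. -/
theorem exists_primitive_vector {ι : Type*} [Fintype ι] {f : ι → ℂ[X]} (hf : f ≠ 0) :
    ∃ (p : ℂ[X]) (g : ι → ℂ[X]), p ≠ 0 ∧ (∀ k, f k = p * g k) ∧ ∀ t, ∃ k, (g k).eval t ≠ 0 := by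
  classical
  let : NormalizedGCDMonoid ℂ[X] := Classical.choice inferInstance
  obtain ⟨k₀, hk₀⟩ := Function.ne_iff.1 hf
  obtain ⟨g, hg, hg1⟩ := Finset.extract_gcd f (s := Finset.univ) ⟨k₀, Finset.mem_univ _⟩
  refine ⟨Finset.univ.gcd f, g, fun h0 => hk₀ ?_, fun k => hg k (Finset.mem_univ _), fun t => ?_⟩
  · rw [hg k₀ (Finset.mem_univ _), h0, zero_mul, Pi.zero_apply]
  · by_contra! h
    have : X - C t ∣ Finset.univ.gcd g := Finset.dvd_gcd fun k _ => dvd_iff_isRoot.2 (h k)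
    rw [hg1] at this
    exact not_isUnit_X_sub_C t (isUnit_of_dvd_one this)

/-- The homogenization of degree `d` of a polynomial of degree at most `d`. -/
noncomputable def homogenizePolynomial (d : ℕ) (p : ℂ[X]) : MvPolynomial (Fin 2) ℂ :=
  ∑ l ∈ Finset.range (d + 1),
    MvPolynomial.C (p.coeff l) * (MvPolynomial.X 0 ^ (d - l) * MvPolynomial.X 1 ^ l)

theorem homogenizePolynomial_isHomogeneous (d : ℕ) (p : ℂ[X]) :
    (homogenizePolynomial d p).IsHomogeneous d := by
  refine MvPolynomial.IsHomogeneous.sum _ _ _ fun l hl => ?_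
  have h := ((MvPolynomial.isHomogeneous_X_pow (R := ℂ) (0 : Fin 2) (d - l)).mul
    (MvPolynomial.isHomogeneous_X_pow (R := ℂ) (1 : Fin 2) l)).C_mul (p.coeff l)
  rwa [Nat.sub_add_cancel (Nat.lt_succ_iff.1 (Finset.mem_range.1 hl))] at h

theorem eval_homogenizePolynomial (d : ℕ) (p : ℂ[X]) (c : Fin 2 → ℂ) :
    MvPolynomial.eval c (homogenizePolynomial d p) =
      ∑ l ∈ Finset.range (d + 1), p.coeff l * (c 0 ^ (d - l) * c 1 ^ l) := by
  simp [homogenizePolynomial]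

theorem eval_homogenizePolynomial_of_ne {d : ℕ} {p : ℂ[X]} (hp : p.natDegree ≤ d) {c : Fin 2 → ℂ}
    (hc : c 0 ≠ 0) :
    MvPolynomial.eval c (homogenizePolynomial d p) = c 0 ^ d * p.eval (c 1 / c 0) := by
  rw [eval_homogenizePolynomial, eval_eq_sum_range' (Nat.lt_succ_of_le hp), Finset.mul_sum]
  refine Finset.sum_congr rfl fun l hl => ?_
  have : c 0 ^ d = c 0 ^ (d - l) * c 0 ^ l := by
    rw [← pow_add, Nat.sub_add_cancel (Nat.lt_succ_iff.1 (Finset.mem_range.1 hl))]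
  rw [this, div_pow]
  field_simp

theorem eval_homogenizePolynomial_of_eq {d : ℕ} {p : ℂ[X]} {c : Fin 2 → ℂ} (hc : c 0 = 0) :
    MvPolynomial.eval c (homogenizePolynomial d p) = p.coeff d * c 1 ^ d := by
  rw [eval_homogenizePolynomial, Finset.sum_range_succ, Finset.sum_eq_zero]
  · simp
  · intro l hl
    have := Finset.mem_range.1 hl
    rw [hc, zero_pow (by omega), zero_mul, mul_zero]

end PolynomialKernel

section SlotBasis

variable {m : ℕ} {V : Fin m → Type*} [∀ r, AddCommGroup (V r)] [∀ r, Module ℂ (V r)]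

/-- A contraction in slot `j` vanishes as soon as it vanishes on basis vectors. -/
theorem tensorForm_update_eq_zero (x : ∀ r, Basis (Fin 2) ℂ (V r)) {j : Fin m} {v : V j}
    {T : TensorDual V}
    (h : ∀ σ : Fin m → Fin 2, tensorForm T (Function.update (fun r => x r (σ r)) j v) = 0)
    (u : ∀ r, V r) : tensorForm T (Function.update u j v) = 0 := by
  let L : ∀ r, V r →ₗ[ℂ] V r :=
    Function.update (fun r => LinearMap.id) j (((x j).coord 0).smulRight v)
  have hL (u : ∀ r, V r) : (fun r => L r (u r)) =
      Function.update u j (((x j).coord 0 (u j)) • v) := by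
    funext r
    by_cases hr : r = j
    · subst hr
      simp [L]
    · simp [L, hr]
  have h0 : (tensorForm T).compLinearMap L = 0 := by
    refine Basis.ext_multilinear x fun σ => ?_
    rw [MultilinearMap.compLinearMap_apply, hL, MultilinearMap.map_update_smul, h, smul_zero]
    rfl
  have h1 := congr_arg (fun F => F (Function.update u j (x j 0))) h0
  simp only [MultilinearMap.compLinearMap_apply, hL] at h1
  simpa using h1

end SlotBasis

namespace FactorizationStructure

open Filter

variable {m : ℕ} {V : Fin m → Type*} [∀ r, AddCommGroup (V r)] [∀ r, Module ℂ (V r)]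
  {𝔥 : Type*} [AddCommGroup 𝔥] [Module ℂ 𝔥] (φ : FactorizationStructure V 𝔥)

theorem finiteDimensional_slot (φ : FactorizationStructure V 𝔥) (r : Fin m) :
    FiniteDimensional ℂ (V r) :=
  finite_of_finrank_pos (by rw [φ.finrank_slot]; omega)

theorem finiteDimensional_source (φ : FactorizationStructure V 𝔥) : FiniteDimensional ℂ 𝔥 :=
  finite_of_finrank_pos (by rw [φ.finrank_source]; omega)

theorem finrank_comap_eq_one {A : Submodule ℂ (TensorDual V)}
    (h : finrank ℂ ↥(LinearMap.range φ.toLinearMap ⊓ A) = 1) :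
    finrank ℂ ↥((LinearMap.range φ.toLinearMap ⊓ A).comap φ.toLinearMap) = 1 := by
  rw [(Submodule.equivMapOfInjective φ.toLinearMap φ.injective _).finrank_eq]
  rwa [Submodule.map_comap_eq, ← inf_assoc, inf_idem]

/-- The kernel of the pencil of contractions in slot `j` is generically a line, spanned by a
polynomial vector; dividing by the common factors and homogenizing gives a regular map. -/
theorem exists_isCurveExtension (j : Fin m) : ∃ ψ, φ.IsCurveExtension j ψ := by
  classical
  have := φ.finiteDimensional_slot
  have := φ.finiteDimensional_source
  let b : Basis (Fin (m + 1)) ℂ 𝔥 := finBasisOfFinrankEq ℂ 𝔥 φ.finrank_source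
  let x : ∀ r, Basis (Fin 2) ℂ (V r) := fun r => finBasisOfFinrankEq ℂ (V r) (φ.finrank_slot r)
  let A : Fin 2 → (Fin m → Fin 2) → Fin (m + 1) → ℂ := fun i σ k =>
    tensorForm (φ.toLinearMap (b k)) (Function.update (fun r => x r (σ r)) j (x j i))
  have hA (c : Fin 2 → ℂ) (y : Fin (m + 1) → ℂ) (σ : Fin m → Fin 2) :
      tensorForm (φ.toLinearMap (∑ k, y k • b k))
        (Function.update (fun r => x r (σ r)) j (c 0 • x j 0 + c 1 • x j 1)) =
        ∑ k, (c 0 * A 0 σ k + c 1 * A 1 σ k) * y k := by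
    have hs (u : ∀ r, V r) : tensorForm (φ.toLinearMap (∑ k, y k • b k)) u =
        ∑ k, y k * tensorForm (φ.toLinearMap (b k)) u := by
      simp [map_sum]
    rw [hs]
    refine Finset.sum_congr rfl fun k _ => ?_
    rw [MultilinearMap.map_update_add, MultilinearMap.map_update_smul,
      MultilinearMap.map_update_smul, smul_eq_mul, smul_eq_mul, mul_comm]
  let M : Matrix (Fin m → Fin 2) (Fin (m + 1)) (Polynomial ℂ) := fun σ k =>
    Polynomial.C (A 0 σ k) + Polynomial.X * Polynomial.C (A 1 σ k)
  have hx := linearIndependent_basis_pair (x j)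
  have hM : {t : ℂ | ∃ y : Fin (m + 1) → ℂ, y ≠ 0 ∧
      ∀ σ, ∑ k, (M σ k).eval t * y k = 0}.Infinite := by
    have hgen := (φ.generic_finrank j).eventually_line (φ.finrank_slot j) hx
    refine (frequently_cofinite_iff_infinite.1 (Eventually.frequently ?_))
    filter_upwards [hgen] with t ht
    have h0 := add_smul_ne_zero hx t
    have h1 := φ.finrank_comap_eq_one (ht h0)
    have : Nontrivial ↥((LinearMap.range φ.toLinearMap ⊓ slotAnnihilator j
      (Projectivization.mk ℂ _ h0)).comap φ.toLinearMap) :=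
      nontrivial_of_finrank_pos (R := ℂ) (by omega)
    obtain ⟨⟨z, hz⟩, hz0⟩ := exists_ne (0 : ↥((LinearMap.range φ.toLinearMap ⊓ slotAnnihilator j
      (Projectivization.mk ℂ _ h0)).comap φ.toLinearMap))
    refine ⟨b.repr z, ?_, fun σ => ?_⟩
    · intro h
      refine hz0 (Subtype.ext ?_)
      exact b.repr.map_eq_zero_iff.1 (DFunLike.coe_injective h)
    · have h2 := (mem_slotAnnihilator_mk h0).1 hz.2 (fun r => x r (σ r))
      have h3 := hA ![1, t] (b.repr z) σ
      rw [b.sum_repr] at h3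
      simp only [Matrix.cons_val_zero, Matrix.cons_val_one, one_smul, h2] at h3
      rw [h3]
      simp [M, mul_comm t]
  obtain ⟨f', hf', hMf'⟩ := exists_polynomial_kernel M hM
  obtain ⟨p, f, hp, hpf, hf⟩ := exists_primitive_vector hf'
  have hMf (σ : Fin m → Fin 2) : ∑ k, M σ k * f k = 0 := by
    have := hMf' σ
    simp only [hpf, mul_left_comm _ p, ← Finset.mul_sum] at this
    exact (mul_eq_zero.1 this).resolve_left hp
  let d : ℕ := Finset.univ.sup fun k => (f k).natDegree
  have hd (k) : (f k).natDegree ≤ d :=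
    Finset.le_sup (f := fun k => (f k).natDegree) (Finset.mem_univ k)
  obtain ⟨k₀, hk₀⟩ : ∃ k, (f k).coeff d ≠ 0 := by
    obtain ⟨k, -, hk⟩ := Finset.exists_mem_eq_sup Finset.univ Finset.univ_nonempty
      fun k => (f k).natDegree
    by_cases h0 : f k = 0
    · -- all the `f k` are constants, so `d = 0`
      obtain ⟨k', hk'⟩ := hf 0
      have hd0 : d = 0 := by
        change Finset.univ.sup (fun k => (f k).natDegree) = 0
        rw [hk, h0, Polynomial.natDegree_zero]
      refine ⟨k', ?_⟩
      rwa [hd0, Polynomial.coeff_zero_eq_eval_zero]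
    · refine ⟨k, ?_⟩
      have : d = (f k).natDegree := hk
      rw [this]
      exact Polynomial.leadingCoeff_ne_zero.2 h0
  let F : Fin (m + 1) → MvPolynomial (Fin 2) ℂ := fun k => homogenizePolynomial d (f k)
  have hFne (c : Fin 2 → ℂ) (hc : c ≠ 0) : ∃ k, MvPolynomial.eval c (F k) ≠ 0 := by
    by_cases h0 : c 0 = 0
    · have h1 : c 1 ≠ 0 := fun h1 => hc (funext fun i => by fin_cases i <;> assumption)
      refine ⟨k₀, ?_⟩
      rw [eval_homogenizePolynomial_of_eq h0]
      exact mul_ne_zero hk₀ (pow_ne_zero _ h1)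
    · obtain ⟨k, hk⟩ := hf (c 1 / c 0)
      refine ⟨k, ?_⟩
      rw [eval_homogenizePolynomial_of_ne (hd k) h0]
      exact mul_ne_zero (pow_ne_zero _ h0) hk
  have hFker (c : Fin 2 → ℂ) (σ : Fin m → Fin 2) :
      ∑ k, (c 0 * A 0 σ k + c 1 * A 1 σ k) * MvPolynomial.eval c (F k) = 0 := by
    have hne {c : Fin 2 → ℂ} (h0 : c 0 ≠ 0) :
        ∑ k, (c 0 * A 0 σ k + c 1 * A 1 σ k) * MvPolynomial.eval c (F k) = 0 := by
      have h1 := congr_arg (Polynomial.eval (c 1 / c 0)) (hMf σ)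
      rw [Polynomial.eval_finsetSum, Polynomial.eval_zero] at h1
      rw [← mul_zero (c 0 ^ (d + 1)), ← h1, Finset.mul_sum]
      refine Finset.sum_congr rfl fun k _ => ?_
      rw [eval_homogenizePolynomial_of_ne (hd k) h0]
      simp only [M, Polynomial.eval_mul, Polynomial.eval_add, Polynomial.eval_C,
        Polynomial.eval_X, pow_succ]
      field_simp
    have hcont : Continuous fun s : ℂ =>
        ∑ k, ((![s, c 1] : Fin 2 → ℂ) 0 * A 0 σ k + (![s, c 1] : Fin 2 → ℂ) 1 * A 1 σ k) *
          MvPolynomial.eval ![s, c 1] (F k) := by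
      refine continuous_finsetSum _ fun k _ => ?_
      refine Continuous.mul (by simp only [Matrix.cons_val_zero, Matrix.cons_val_one]; fun_prop) ?_
      refine (MvPolynomial.continuous_eval (F k)).comp (continuous_pi fun i => ?_)
      fin_cases i
      · exact continuous_id
      · exact continuous_const
    have h := eq_of_eventually_cofinite_eq hcont continuous_const (g := fun _ => 0) ?_ (c 0)
    · have hc : (![c 0, c 1] : Fin 2 → ℂ) = c := by
        funext i
        fin_cases i <;> rfl
      simpa only [hc] using h
    · filter_upwards [(Set.finite_singleton (0 : ℂ)).compl_mem_cofinite] with s hs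
      exact hne (c := ![s, c 1]) hs
  let Φ : V j → 𝔥 := fun v => ∑ k, MvPolynomial.eval ((x j).repr v) (F k) • b k
  have hΦne {v : V j} (hv : v ≠ 0) : Φ v ≠ 0 := by
    intro h0
    obtain ⟨k, hk⟩ := hFne ((x j).repr v) fun h =>
      hv ((x j).repr.map_eq_zero_iff.1 (DFunLike.coe_injective h))
    exact hk (Fintype.linearIndependent_iff.1 b.linearIndependent _ h0 k)
  have hΦ (v : V j) (hv : v ≠ 0) : Projectivization.mk ℂ
      (Φ (Projectivization.mk ℂ v hv).rep) (hΦne (Projectivization.rep_nonzero _)) =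
      Projectivization.mk ℂ (Φ v) (hΦne hv) := by
    obtain ⟨a, ha⟩ := Projectivization.exists_smul_eq_mk_rep ℂ v hv
    refine (Projectivization.mk_eq_mk_iff' ℂ _ _ _ _).2 ⟨(a : ℂ) ^ d, ?_⟩
    rw [← ha, Units.smul_def]
    simp only [Φ, Finset.smul_sum, smul_smul, map_smul, Finsupp.coe_smul]
    refine Finset.sum_congr rfl fun k _ => ?_
    rw [eval_smul_of_isHomogeneous (homogenizePolynomial_isHomogeneous d (f k))]
  refine ⟨fun ℓ => Projectivization.mk ℂ (Φ ℓ.rep) (hΦne (Projectivization.rep_nonzero _)),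
    ⟨d, 2, m + 1, x j, b, F, fun k => homogenizePolynomial_isHomogeneous _ _,
      fun v hv => ⟨hΦne hv, hΦ v hv⟩⟩, ?_⟩
  obtain ⟨U, hU, hUne, hU1⟩ := φ.generic_finrank j
  refine ⟨U, hU, hUne, fun ℓ hℓ => ?_⟩
  refine Submodule.eq_of_le_of_finrank_eq ?_ ?_
  · induction ℓ using Projectivization.ind with | h v hv =>
    beta_reduce
    rw [hΦ, Projectivization.submodule_mk, Submodule.span_singleton_le_iff_mem]
    refine ⟨⟨_, rfl⟩, (mem_slotAnnihilator_mk hv).2 (tensorForm_update_eq_zero x fun σ => ?_)⟩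
    have h1 := hA ((x j).repr v) (fun k => MvPolynomial.eval ((x j).repr v) (F k)) σ
    rw [hFker] at h1
    have h2 := (x j).sum_repr v
    rw [Fin.sum_univ_two] at h2
    rwa [h2] at h1
  · rw [Projectivization.finrank_submodule, φ.finrank_comap_eq_one (hU1 ℓ hℓ)]

theorem isCurveExtension_curve (j : Fin m) : φ.IsCurveExtension j (φ.curve j) :=
  Classical.epsilon_spec (φ.exists_isCurveExtension j)

/-- The defining condition of `ψ_j` is closed, so that it holds at every point. -/
theorem mem_slotAnnihilator_of_mem_curve (j : Fin m) (ℓ : ℙ ℂ (V j)) {y : 𝔥}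
    (hy : y ∈ (φ.curve j ℓ).submodule) : φ.toLinearMap y ∈ slotAnnihilator j ℓ := by
  have := φ.finiteDimensional_slot
  obtain ⟨hreg, hgen⟩ := φ.isCurveExtension_curve j
  induction ℓ using Projectivization.ind with | h v hv =>
  obtain ⟨w, hvw⟩ := exists_linearIndependent_pair (φ.finrank_slot j) hv
  obtain ⟨F, hF, hF'⟩ := hreg.exists_line v w
  have h0 : v + (0 : ℂ) • w = v := by simp
  rw [mem_slotAnnihilator_mk hv]
  intro u
  let c (z : V j) : 𝔥 →ₗ[ℂ] ℂ :=
    { toFun := fun y => tensorForm (φ.toLinearMap y) (Function.update u j z)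
      map_add' := fun a b => by simp
      map_smul' := fun a b => by simp }
  have hc (y : 𝔥) (t : ℂ) : c (v + t • w) y = c v y + t * c w y := by
    change tensorForm _ _ = tensorForm _ _ + t * tensorForm _ _
    rw [MultilinearMap.map_update_add, MultilinearMap.map_update_smul, smul_eq_mul]
  have h1 : ∀ t : ℂ, c v (F t) + t * c w (F t) = 0 := by
    refine eq_of_eventually_cofinite_eq ((hF _).add (continuous_id.mul (hF _)))
      continuous_const ?_
    filter_upwards [hgen.eventually_line (φ.finrank_slot j) hvw] with t ht
    have hne := add_smul_ne_zero hvw t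
    obtain ⟨h2, h3⟩ := hF' t hne
    have h4 := ht hne
    rw [h3, Projectivization.submodule_mk] at h4
    have h5 : F t ∈ ℂ ∙ F t := Submodule.mem_span_singleton_self _
    rw [h4] at h5
    change c v (F t) + t * c w (F t) = 0
    rw [← hc]
    exact (mem_slotAnnihilator_mk hne).1 h5.2 u
  obtain ⟨h2, h3⟩ := hF' 0 (by rwa [h0])
  simp only [h0] at h3
  rw [h3, Projectivization.submodule_mk, Submodule.mem_span_singleton] at hy
  obtain ⟨a, rfl⟩ := hy
  have h4 := h1 0
  rw [zero_mul, add_zero] at h4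
  change c v (a • F 0) = 0
  rw [map_smul, h4, smul_zero]

end FactorizationStructure

/-! ### Consequences of the slot form -/

section Symplectic

variable {V : Type*} [AddCommGroup V] [Module ℂ V]

/-- A symplectic form on a plane, as an isomorphism `J : V ≃ V^*`: then `J v` spans the annihilator
of `v`, which makes `ℓ ↦ ℓ⁰` a linear map in coordinates. -/
theorem exists_equiv_dual_self_apply_eq_zero (hV : finrank ℂ V = 2) :
    ∃ J : V ≃ₗ[ℂ] Dual ℂ V, ∀ v, J v v = 0 := by
  have : FiniteDimensional ℂ V := finite_of_finrank_pos (by omega)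
  let x : Basis (Fin 2) ℂ V := finBasisOfFinrankEq ℂ V hV
  let J : V →ₗ[ℂ] Dual ℂ V := (x.coord 0).smulRight (x.coord 1) - (x.coord 1).smulRight (x.coord 0)
  have hJ (v w : V) : J v w = x.coord 0 v * x.coord 1 w - x.coord 1 v * x.coord 0 w := rfl
  have hinj : Function.Injective J := by
    refine (injective_iff_map_eq_zero J).2 fun v hv => x.ext_elem fun i => ?_
    have h0 := hJ v (x 0)
    have h1 := hJ v (x 1)
    rw [hv] at h0 h1
    fin_cases i
    · simpa using h1.symm
    · simpa using h0.symm
  refine ⟨LinearEquiv.ofInjectiveOfFinrankEq J hinj Subspace.dual_finrank_eq.symm, fun v => ?_⟩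
  change J v v = 0
  rw [hJ]
  ring

theorem annihilatorPoint_mk (hV : finrank ℂ V = 2) {J : V ≃ₗ[ℂ] Dual ℂ V} (hJ : ∀ v, J v v = 0)
    {v : V} (hv : v ≠ 0) :
    annihilatorPoint hV (Projectivization.mk ℂ v hv) =
      Projectivization.mk ℂ (J v) (J.map_ne_zero_iff.2 hv) := by
  have : FiniteDimensional ℂ V := finite_of_finrank_pos (by omega)
  refine Projectivization.submodule_injective (Eq.symm (Submodule.eq_of_le_of_finrank_eq ?_ ?_))
  · rw [annihilatorPoint, Projectivization.submodule_mk'', Projectivization.submodule_mk,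
      Submodule.span_singleton_le_iff_mem, Submodule.mem_dualAnnihilator]
    intro w hw
    obtain ⟨c, rfl⟩ := Submodule.mem_span_singleton.1 hw
    rw [map_smul, hJ, smul_zero]
  · rw [Projectivization.finrank_submodule, Projectivization.finrank_submodule]

theorem mem_span_of_apply_eq_zero (hV : finrank ℂ V = 2) {J : V ≃ₗ[ℂ] Dual ℂ V}
    (hJ : ∀ v, J v v = 0) {v : V} (hv : v ≠ 0) {a : Dual ℂ V} (ha : a v = 0) :
    a ∈ ℂ ∙ J v := by
  have h : a ∈ (Projectivization.mk ℂ v hv).submodule.dualAnnihilator := by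
    rw [Submodule.mem_dualAnnihilator]
    intro w hw
    obtain ⟨c, rfl⟩ := Submodule.mem_span_singleton.1 hw
    rw [map_smul, ha, smul_zero]
  have h1 : (annihilatorPoint hV (Projectivization.mk ℂ v hv)).submodule = _ :=
    Projectivization.submodule_mk'' _ _
  rwa [← h1, annihilatorPoint_mk hV hJ hv] at h

end Symplectic

namespace FactorizationStructure

open Filter

variable {m : ℕ} {V : Fin m → Type*} [∀ r, AddCommGroup (V r)] [∀ r, Module ℂ (V r)]
  {𝔥 : Type*} [AddCommGroup 𝔥] [Module ℂ 𝔥] (φ : FactorizationStructure V 𝔥)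

theorem mem_slotAnnihilator_of_map_curve_eq {j : Fin m} {ℓ : ℙ ℂ (V j)} {T : TensorDual V}
    (h : (φ.curve j ℓ).submodule.map φ.toLinearMap = ℂ ∙ T) : T ∈ slotAnnihilator j ℓ := by
  have h2 : T ∈ (φ.curve j ℓ).submodule.map φ.toLinearMap := by
    rw [h]
    exact Submodule.mem_span_singleton_self _
  obtain ⟨y, hy, rfl⟩ := h2
  exact φ.mem_slotAnnihilator_of_mem_curve j _ hy

/-- The line of the slot form at `ℓ = [v]` is spanned by the tensor with `e_r (J v)` in slot `r ∈ S`
and `γ` elsewhere, where `e_r` induces `g_r` and `J v` spans `ℓ⁰`. -/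
theorem productLine_annihilatorPoint {j : Fin m} {J : V j ≃ₗ[ℂ] Dual ℂ (V j)}
    (hJ : ∀ v, J v v = 0) (S : Finset (Fin m))
    (e : (r : {r : Fin m // r ∈ S}) → Dual ℂ (V j) ≃ₗ[ℂ] Dual ℂ (V r))
    {γ : ⨂[ℂ] r : {r : Fin m // r ∉ S}, Dual ℂ (V r)} (hγ : γ ≠ 0) {v : V j} (hv : v ≠ 0) :
    productLine S (fun r => Projectivization.map (e r).toLinearMap (e r).injective
        (annihilatorPoint (φ.finrank_slot j) (Projectivization.mk ℂ v hv)))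
        (Projectivization.mk ℂ γ hγ) =
      Submodule.span ℂ {joinSlots V S (PiTensorProduct.tprod ℂ (fun r => e r (J v)) ⊗ₜ[ℂ] γ)} := by
  rw [annihilatorPoint_mk _ hJ]
  exact productLine_mk S (fun r => e r (J v))
    (fun r => (e r).map_ne_zero_iff.2 (J.map_ne_zero_iff.2 hv)) γ hγ

variable {φ}

theorem IsSlotForm.exists_tensor {j : Fin m} {S : Finset (Fin m)}
    {Γ : ℙ ℂ (⨂[ℂ] r : {r : Fin m // r ∉ S}, Dual ℂ (V r))}
    {g : (r : {r : Fin m // r ∈ S}) → ℙ ℂ (Dual ℂ (V j)) → ℙ ℂ (Dual ℂ (V r))}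
    (h : φ.IsSlotForm j S Γ g) {J : V j ≃ₗ[ℂ] Dual ℂ (V j)} (hJ : ∀ v, J v v = 0) :
    ∃ (e : (r : {r : Fin m // r ∈ S}) → Dual ℂ (V j) ≃ₗ[ℂ] Dual ℂ (V r))
      (γ : ⨂[ℂ] r : {r : Fin m // r ∉ S}, Dual ℂ (V r)), γ ≠ 0 ∧
      (∀ r, g r = Projectivization.map (e r).toLinearMap (e r).injective) ∧
      ∀ v (hv : v ≠ 0), (φ.curve j (Projectivization.mk ℂ v hv)).submodule.map φ.toLinearMap =
        Submodule.span ℂ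
          {joinSlots V S (PiTensorProduct.tprod ℂ (fun r => e r (J v)) ⊗ₜ[ℂ] γ)} := by
  obtain ⟨-, hg, hS⟩ := h
  choose e he using hg
  induction Γ using Projectivization.ind with | h γ hγ =>
  refine ⟨e, γ, hγ, he, fun v hv => ?_⟩
  rw [hS, ← φ.productLine_annihilatorPoint hJ S e hγ hv]
  simp only [he]

/-- For `r ∈ S` the slot form shows that `ψ_j ℓ` also satisfies the condition defining `ψ_r` at the
point with annihilator `g_r ℓ⁰`, so that `ψ_r` is a reparametrization of `ψ_j`. -/
theorem IsSlotForm.curvesEquivalent_of_mem {j : Fin m} {S : Finset (Fin m)}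
    {Γ : ℙ ℂ (⨂[ℂ] r : {r : Fin m // r ∉ S}, Dual ℂ (V r))}
    {g : (r : {r : Fin m // r ∈ S}) → ℙ ℂ (Dual ℂ (V j)) → ℙ ℂ (Dual ℂ (V r))}
    (h : φ.IsSlotForm j S Γ g) {r : Fin m} (hr : r ∈ S) : φ.CurvesEquivalent r j := by
  have := φ.finiteDimensional_source
  obtain ⟨J, hJ⟩ := exists_equiv_dual_self_apply_eq_zero (φ.finrank_slot j)
  obtain ⟨K, hK⟩ := exists_equiv_dual_self_apply_eq_zero (φ.finrank_slot r)
  obtain ⟨e, γ, hγ, -, hφ⟩ := h.exists_tensor hJ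
  let k : V j ≃ₗ[ℂ] V r := (J.trans (e ⟨r, hr⟩)).trans K.symm
  have hk (v : V j) : e ⟨r, hr⟩ (J v) (k v) = 0 := by
    have := hK (k v)
    rwa [LinearEquiv.trans_apply, LinearEquiv.apply_symm_apply] at this
  have hmem {v : V j} (hv : v ≠ 0) {y : 𝔥}
      (hy : y ∈ (φ.curve j (Projectivization.mk ℂ v hv)).submodule) :
      φ.toLinearMap y ∈
        slotAnnihilator r (Projectivization.mk ℂ (k v) (k.map_ne_zero_iff.2 hv)) := by
    have h1 := Submodule.mem_map_of_mem (f := φ.toLinearMap) hy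
    rw [hφ, Submodule.mem_span_singleton] at h1
    obtain ⟨c, hc⟩ := h1
    rw [mem_slotAnnihilator_mk]
    intro u
    rw [← hc, map_smul, smul_apply, tensorForm_joinSlots,
      Finset.prod_eq_zero (Finset.mem_univ ⟨r, hr⟩), zero_mul, smul_zero]
    rw [Function.update_self]
    exact hk v
  obtain ⟨hregj, -⟩ := φ.isCurveExtension_curve j
  obtain ⟨hregr, hgenr⟩ := φ.isCurveExtension_curve r
  have key (v : V j) (hv : v ≠ 0) : φ.curve j (Projectivization.mk ℂ v hv) =
      φ.curve r (Projectivization.mk ℂ (k v) (k.map_ne_zero_iff.2 hv)) := by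
    obtain ⟨w, hvw⟩ := exists_linearIndependent_pair (φ.finrank_slot j) hv
    have hkvw := linearIndependent_pair_map k hvw
    refine hregj.eq_of_eventually hregr k hvw ?_ hv
    filter_upwards [hgenr.eventually_line (φ.finrank_slot r) hkvw] with t ht
    have ht' := ht (add_smul_ne_zero hkvw t)
    have hkt : k v + t • k w = k (v + t • w) := by simp
    simp only [hkt] at ht'
    refine Projectivization.submodule_injective (Submodule.eq_of_le_of_finrank_eq ?_ ?_)
    · rw [ht']
      exact fun y hy => ⟨⟨y, rfl⟩, hmem _ hy⟩
    · rw [Projectivization.finrank_submodule, Projectivization.finrank_submodule]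
  refine Set.Subset.antisymm ?_ ?_
  · rintro _ ⟨ℓ, rfl⟩
    induction ℓ using Projectivization.ind with | h w hw =>
    refine ⟨Projectivization.mk ℂ (k.symm w) (k.symm.map_ne_zero_iff.2 hw), ?_⟩
    rw [key]
    simp only [LinearEquiv.apply_symm_apply]
  · rintro _ ⟨ℓ, rfl⟩
    induction ℓ using Projectivization.ind with | h w hw =>
    exact ⟨_, (key w hw).symm⟩

/-- If `Im ψ_i = Im ψ_j` and `i ∉ S`, then every vector annihilates the constant factor `γ` in slot
`i`, so that `γ = 0`. -/
theorem IsSlotForm.mem_of_curvesEquivalent {j : Fin m} {S : Finset (Fin m)}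
    {Γ : ℙ ℂ (⨂[ℂ] r : {r : Fin m // r ∉ S}, Dual ℂ (V r))}
    {g : (r : {r : Fin m // r ∈ S}) → ℙ ℂ (Dual ℂ (V j)) → ℙ ℂ (Dual ℂ (V r))}
    (h : φ.IsSlotForm j S Γ g) {i : Fin m} (hi : φ.CurvesEquivalent i j) : i ∈ S := by
  have := φ.finiteDimensional_slot
  obtain ⟨J, hJ⟩ := exists_equiv_dual_self_apply_eq_zero (φ.finrank_slot j)
  obtain ⟨e, γ, hγ, -, hφ⟩ := h.exists_tensor hJ
  by_contra hiS
  have hker {v : V i} (hv : v ≠ 0) (u : ∀ r : {r : Fin m // r ∉ S}, V r) :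
      tensorForm γ (Function.update u ⟨i, hiS⟩ v) = 0 := by
    obtain ⟨ℓ, hℓ⟩ : φ.curve i (Projectivization.mk ℂ v hv) ∈ Set.range (φ.curve j) :=
      hi ▸ Set.mem_range_self _
    induction ℓ using Projectivization.ind with | h w hw =>
    exact tensorForm_update_eq_zero_of_joinSlots_mem
      (fun r => (e r).map_ne_zero_iff.2 (J.map_ne_zero_iff.2 hw)) hiS hv
      (φ.mem_slotAnnihilator_of_map_curve_eq (ℓ := Projectivization.mk ℂ v hv)
        (hℓ ▸ hφ w hw)) u
  let x : Basis (Fin 2) ℂ (V i) := finBasisOfFinrankEq ℂ (V i) (φ.finrank_slot i)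
  exact hγ (eq_zero_of_slot_eq_zero (M := fun r : {r : Fin m // r ∉ S} => V r) (j := ⟨i, hiS⟩)
    (φ.finrank_slot i) (linearIndependent_basis_pair x) (hker (x.ne_zero 0)) (hker (x.ne_zero 1)))

theorem IsSlotForm.mem_iff {j : Fin m} {S : Finset (Fin m)}
    {Γ : ℙ ℂ (⨂[ℂ] r : {r : Fin m // r ∉ S}, Dual ℂ (V r))}
    {g : (r : {r : Fin m // r ∈ S}) → ℙ ℂ (Dual ℂ (V j)) → ℙ ℂ (Dual ℂ (V r))}
    (h : φ.IsSlotForm j S Γ g) (i : Fin m) : i ∈ S ↔ φ.CurvesEquivalent i j :=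
  ⟨h.curvesEquivalent_of_mem, h.mem_of_curvesEquivalent⟩

theorem IsSlotForm.isDecomposableCurve {j : Fin m} {S : Finset (Fin m)}
    {Γ : ℙ ℂ (⨂[ℂ] r : {r : Fin m // r ∉ S}, Dual ℂ (V r))}
    {g : (r : {r : Fin m // r ∈ S}) → ℙ ℂ (Dual ℂ (V j)) → ℙ ℂ (Dual ℂ (V r))}
    (h : φ.IsSlotForm j S Γ g) : φ.IsDecomposableCurve j := by
  have hS : {i : Fin m | φ.CurvesEquivalent i j} = (S : Set (Fin m)) :=
    Set.ext fun i => (h.mem_iff i).symm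
  rw [IsDecomposableCurve, hS, Set.ncard_coe_finset, h.1]

theorem IsSlotForm.self_mem {j : Fin m} {S : Finset (Fin m)}
    {Γ : ℙ ℂ (⨂[ℂ] r : {r : Fin m // r ∉ S}, Dual ℂ (V r))}
    {g : (r : {r : Fin m // r ∈ S}) → ℙ ℂ (Dual ℂ (V j)) → ℙ ℂ (Dual ℂ (V r))}
    (h : φ.IsSlotForm j S Γ g) : j ∈ S :=
  (h.mem_iff j).2 rfl

theorem IsSlotForm.apply_self_eq_id {j : Fin m} {S : Finset (Fin m)}
    {Γ : ℙ ℂ (⨂[ℂ] r : {r : Fin m // r ∉ S}, Dual ℂ (V r))}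
    {g : (r : {r : Fin m // r ∈ S}) → ℙ ℂ (Dual ℂ (V j)) → ℙ ℂ (Dual ℂ (V r))}
    (h : φ.IsSlotForm j S Γ g) : g ⟨j, h.self_mem⟩ = id := by
  have := φ.finiteDimensional_slot
  obtain ⟨J, hJ⟩ := exists_equiv_dual_self_apply_eq_zero (φ.finrank_slot j)
  obtain ⟨e, γ, hγ, he, hφ⟩ := h.exists_tensor hJ
  funext p
  induction p using Projectivization.ind with | h a ha =>
  obtain ⟨v, rfl⟩ := J.surjective a
  have hv : v ≠ 0 := J.map_ne_zero_iff.1 ha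
  rw [he, Projectivization.map_mk, id]
  refine (mk_eq_mk_of_mem_span ha _ (mem_span_of_apply_eq_zero (φ.finrank_slot j) hJ hv ?_)).symm
  exact apply_eq_zero_of_joinSlots_mem
    (fun r => (e r).map_ne_zero_iff.2 (J.map_ne_zero_iff.2 hv)) hγ h.self_mem hv
    (φ.mem_slotAnnihilator_of_map_curve_eq (hφ v hv))

end FactorizationStructure

/-! ### Factoring polynomial tensors slot by slot -/

section PolynomialTensors

open Polynomial

theorem exists_isCoprime_of_ne_zero {p q : ℂ[X]} (h : p ≠ 0 ∨ q ≠ 0) :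
    ∃ (g : ℂ[X]) (a : Fin 2 → ℂ[X]), g ≠ 0 ∧ IsCoprime (a 0) (a 1) ∧ p = g * a 0 ∧ q = g * a 1 := by
  classical
  let : GCDMonoid ℂ[X] := EuclideanDomain.gcdMonoid ℂ[X]
  have hg : gcd p q ≠ 0 := fun h0 => by
    rw [gcd_eq_zero_iff] at h0
    tauto
  exact ⟨gcd p q, ![p / gcd p q, q / gcd p q], hg, isCoprime_div_gcd_div_gcd_of_gcd_ne_zero hg,
    (EuclideanDomain.mul_div_cancel' hg (gcd_dvd_left p q)).symm,
    (EuclideanDomain.mul_div_cancel' hg (gcd_dvd_right p q)).symm⟩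

variable {I : Type*} [DecidableEq I]

/-- If the `2 × 2` minors of a polynomial tensor with respect to slot `i` vanish, then a primitive
vector can be split off in slot `i`. -/
theorem exists_slot_factor {C : (I → Fin 2) → ℂ[X]} {i : I}
    (hC : ∀ σ σ', C (Function.update σ i 0) * C (Function.update σ' i 1) =
      C (Function.update σ' i 0) * C (Function.update σ i 1)) (h0 : ∃ σ, C σ ≠ 0) :
    ∃ (a : Fin 2 → ℂ[X]) (u v : ℂ[X]), IsCoprime (a 0) (a 1) ∧
      ∀ σ, C σ = a (σ i) * (u * C (Function.update σ i 0) + v * C (Function.update σ i 1)) := by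
  obtain ⟨τ, hτ⟩ := h0
  have hτ' : C (Function.update τ i 0) ≠ 0 ∨ C (Function.update τ i 1) ≠ 0 := by
    by_contra! h
    refine hτ ?_
    rw [← Function.update_eq_self i τ]
    generalize τ i = k
    fin_cases k
    · exact h.1
    · exact h.2
  obtain ⟨g, a, hg, ha, hp, hq⟩ := exists_isCoprime_of_ne_zero hτ'
  have hrel (σ : I → Fin 2) :
      a 0 * C (Function.update σ i 1) = a 1 * C (Function.update σ i 0) := by
    have := hC τ σ
    rw [hp, hq] at this
    refine mul_left_cancel₀ hg ?_
    linear_combination this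
  obtain ⟨u, v, huv⟩ := id ha
  refine ⟨a, u, v, ha, fun σ => ?_⟩
  have hk (k : Fin 2) : C (Function.update σ i k) =
      a k * (u * C (Function.update σ i 0) + v * C (Function.update σ i 1)) := by
    fin_cases k
    · change C (Function.update σ i 0) =
        a 0 * (u * C (Function.update σ i 0) + v * C (Function.update σ i 1))
      linear_combination (-v) * hrel σ - C (Function.update σ i 0) * huv
    · change C (Function.update σ i 1) =
        a 1 * (u * C (Function.update σ i 0) + v * C (Function.update σ i 1))
      linear_combination u * hrel σ - C (Function.update σ i 1) * huv
  have := hk (σ i)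
  rwa [Function.update_eq_self] at this

theorem exists_index_ne_zero {a : I → Fin 2 → ℂ[X]} {S : Finset I}
    (ha : ∀ i ∈ S, IsCoprime (a i 0) (a i 1)) : ∃ τ : I → Fin 2, ∀ i ∈ S, a i (τ i) ≠ 0 := by
  have h (i : I) : ∃ k, i ∈ S → a i k ≠ 0 := by
    by_cases hi : i ∈ S
    · rcases (ha i hi).ne_zero_or_ne_zero with h | h
      · exact ⟨0, fun _ => h⟩
      · exact ⟨1, fun _ => h⟩
    · exact ⟨0, fun h => absurd h hi⟩
  choose τ hτ using h
  exact ⟨τ, fun i hi => hτ i hi⟩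

/-- If the minors of a nonzero polynomial tensor with respect to each slot in `S` vanish, then it is
the product of primitive vectors in the slots in `S` and of a tensor in the other slots. -/
theorem exists_slots_factors {T : (I → Fin 2) → ℂ[X]} (S : Finset I)
    (hT : ∀ i ∈ S, ∀ σ σ', T (Function.update σ i 0) * T (Function.update σ' i 1) =
      T (Function.update σ' i 0) * T (Function.update σ i 1)) (h0 : ∃ σ, T σ ≠ 0) :
    ∃ (a : I → Fin 2 → ℂ[X]) (C : (I → Fin 2) → ℂ[X]),
      (∀ i ∈ S, IsCoprime (a i 0) (a i 1)) ∧
      (∀ σ σ', (∀ r ∉ S, σ r = σ' r) → C σ = C σ') ∧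
      ∀ σ, T σ = (∏ r ∈ S, a r (σ r)) * C σ := by
  induction S using Finset.induction_on with
  | empty =>
    exact ⟨fun _ _ => 0, T, by simp, fun σ σ' h => by rw [funext fun r => h r (by simp)], by simp⟩
  | insert i S hiS ih =>
    obtain ⟨a, C, ha, hC, hTC⟩ := ih fun r hr => hT r (Finset.mem_insert_of_mem hr)
    obtain ⟨τ, hτ⟩ := exists_index_ne_zero ha
    have hP : ∏ r ∈ S, a r (τ r) ≠ 0 := Finset.prod_ne_zero_iff.2 hτ
    -- entries of `C` are read off from `T` by moving the indices in `S` to `τ`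
    have hread (σ : I → Fin 2) (k : Fin 2) :
        T (Function.update (fun r => if r ∈ S then τ r else σ r) i k) =
          (∏ r ∈ S, a r (τ r)) * C (Function.update σ i k) := by
      rw [hTC]
      congr 1
      · refine Finset.prod_congr rfl fun r hr => ?_
        have hri : r ≠ i := fun h => hiS (h ▸ hr)
        rw [Function.update_of_ne hri, if_pos hr]
      · refine hC _ _ fun r hr => ?_
        by_cases hri : r = i
        · subst hri
          simp
        · rw [Function.update_of_ne hri, Function.update_of_ne hri, if_neg hr]
    have hCmin : ∀ σ σ', C (Function.update σ i 0) * C (Function.update σ' i 1) =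
        C (Function.update σ' i 0) * C (Function.update σ i 1) := by
      intro σ σ'
      have := hT i (Finset.mem_insert_self _ _) (fun r => if r ∈ S then τ r else σ r)
        (fun r => if r ∈ S then τ r else σ' r)
      simp only [hread] at this
      refine mul_left_cancel₀ (mul_ne_zero hP hP) ?_
      linear_combination this
    have hC0 : ∃ σ, C σ ≠ 0 := by
      obtain ⟨σ, hσ⟩ := h0
      refine ⟨σ, fun h => hσ ?_⟩
      rw [hTC, h, mul_zero]
    obtain ⟨b, u, v, hb, hCb⟩ := exists_slot_factor hCmin hC0
    refine ⟨Function.update a i b,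
      fun σ => u * C (Function.update σ i 0) + v * C (Function.update σ i 1), fun r hr => ?_,
      fun σ σ' h => ?_, fun σ => ?_⟩
    · by_cases hri : r = i
      · subst hri
        rwa [Function.update_self]
      · rw [Function.update_of_ne hri]
        exact ha r ((Finset.mem_insert.1 hr).resolve_left hri)
    · have hk (k : Fin 2) : C (Function.update σ i k) = C (Function.update σ' i k) := by
        refine hC _ _ fun r hr => ?_
        by_cases hri : r = i
        · subst hri
          simp
        · rw [Function.update_of_ne hri, Function.update_of_ne hri]
          exact h r (by simp [hri, hr])
      simp only [hk]
    · have hprod : ∏ r ∈ S, Function.update a i b r (σ r) = ∏ r ∈ S, a r (σ r) := by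
        refine Finset.prod_congr rfl fun r hr => ?_
        have hri : r ≠ i := fun h => hiS (h ▸ hr)
        rw [Function.update_of_ne hri]
      rw [Finset.prod_insert hiS, hprod, Function.update_self, hTC, hCb]
      ring

/-- If the factors in the slots in `S` are not constant and the degree of the tensor is at most
`|S|`, then these factors are of degree one and the remaining factor is constant. -/
theorem natDegree_slots_factors {a : I → Fin 2 → ℂ[X]} {C T : (I → Fin 2) → ℂ[X]} {S : Finset I}
    (hC : ∀ σ σ', (∀ r ∉ S, σ r = σ' r) → C σ = C σ')
    (hTC : ∀ σ, T σ = (∏ r ∈ S, a r (σ r)) * C σ) (hT : ∀ σ, (T σ).natDegree ≤ S.card)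
    (h0 : ∃ σ, T σ ≠ 0) (ha : ∀ i ∈ S, ∃ k, 1 ≤ (a i k).natDegree) :
    (∀ i ∈ S, ∀ k, (a i k).natDegree ≤ 1) ∧ ∀ σ, (C σ).natDegree = 0 := by
  choose τ hτ using fun i => Finite.exists_max fun k => (a i k).natDegree
  have hτ1 (i : I) (hi : i ∈ S) : 1 ≤ (a i (τ i)).natDegree := by
    obtain ⟨k, hk⟩ := ha i hi
    exact hk.trans (hτ i k)
  have hsum {σ : I → Fin 2} (hσ : C σ ≠ 0) :
      ∑ r ∈ S, (a r (τ r)).natDegree + (C σ).natDegree ≤ S.card := by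
    have hCσ : C (fun r => if r ∈ S then τ r else σ r) = C σ :=
      hC _ _ fun r hr => if_neg hr
    have hprod : ∏ r ∈ S, a r (if r ∈ S then τ r else σ r) = ∏ r ∈ S, a r (τ r) :=
      Finset.prod_congr rfl fun r hr => by rw [if_pos hr]
    have hne : ∀ r ∈ S, a r (τ r) ≠ 0 := fun r hr h => by
      have := hτ1 r hr
      rw [h, natDegree_zero] at this
      omega
    have := hT fun r => if r ∈ S then τ r else σ r
    rwa [hTC, hCσ, hprod, natDegree_mul (Finset.prod_ne_zero_iff.2 hne) hσ,
      natDegree_prod _ _ hne] at this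
  have hcard : S.card ≤ ∑ r ∈ S, (a r (τ r)).natDegree := by
    rw [Finset.card_eq_sum_ones]
    exact Finset.sum_le_sum hτ1
  refine ⟨fun i hi k => (hτ i k).trans ?_, fun σ => ?_⟩
  · obtain ⟨σ, hσ⟩ := h0
    have hCσ : C σ ≠ 0 := fun h => hσ (by rw [hTC, h, mul_zero])
    have h1 := hsum hCσ
    have h2 : ∑ r ∈ S, 1 = ∑ r ∈ S, (a r (τ r)).natDegree := by
      rw [← Finset.card_eq_sum_ones]
      omega
    exact ((Finset.sum_eq_sum_iff_of_le hτ1).1 h2 i hi).ge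
  · by_cases hσ : C σ = 0
    · rw [hσ, natDegree_zero]
    · have h1 := hsum hσ
      omega

/-- The coefficient vectors of a primitive vector of degree one are independent. -/
theorem coeff_det_ne_zero {a : Fin 2 → ℂ[X]} (ha : IsCoprime (a 0) (a 1))
    (h1 : ∀ k, (a k).natDegree ≤ 1) (h2 : ∃ k, 1 ≤ (a k).natDegree) :
    (a 0).coeff 0 * (a 1).coeff 1 - (a 1).coeff 0 * (a 0).coeff 1 ≠ 0 := by
  intro hdet
  have heval (k : Fin 2) (t : ℂ) : (a k).eval t = (a k).coeff 0 + (a k).coeff 1 * t := by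
    conv_lhs => rw [eq_X_add_C_of_natDegree_le_one (h1 k)]
    simp only [eval_add, eval_mul, eval_C, eval_X]
    ring
  obtain ⟨k, hk⟩ := h2
  have hk1 : (a k).coeff 1 ≠ 0 := by
    have hdeg : (a k).natDegree = 1 := le_antisymm (h1 k) hk
    rw [← hdeg]
    exact leadingCoeff_ne_zero.2 fun h => by simp [h] at hdeg
  have hroot (l : Fin 2) : (a l).eval (-(a k).coeff 0 / (a k).coeff 1) = 0 := by
    have hkl : (a l).coeff 0 * (a k).coeff 1 - (a k).coeff 0 * (a l).coeff 1 = 0 := by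
      fin_cases k <;> fin_cases l
      · exact sub_self _
      · change (a 1).coeff 0 * (a 0).coeff 1 - (a 0).coeff 0 * (a 1).coeff 1 = 0
        linear_combination -hdet
      · exact hdet
      · exact sub_self _
    rw [heval]
    field_simp
    linear_combination hkl
  obtain ⟨u, v, huv⟩ := ha
  have := congr_arg (eval (-(a k).coeff 0 / (a k).coeff 1)) huv
  simp [hroot] at this

end PolynomialTensors

/-! ### Decomposable curves -/

section Parametrized

variable {m : ℕ} {V : Fin m → Type*} [∀ r, AddCommGroup (V r)] [∀ r, Module ℂ (V r)]

theorem update_basis_index (x : ∀ r, Basis (Fin 2) ℂ (V r)) (σ : Fin m → Fin 2) (i : Fin m)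
    (k : Fin 2) : Function.update (fun r => x r (σ r)) i (x i k) =
      fun r => x r (Function.update σ i k r) := by
  funext r
  by_cases hr : r = i
  · subst hr
    simp
  · rw [Function.update_of_ne hr, Function.update_of_ne hr]

theorem tensorForm_update_basis (x : ∀ r, Basis (Fin 2) ℂ (V r)) (A : TensorDual V)
    (σ : Fin m → Fin 2) (i : Fin m) (p q : ℂ) :
    tensorForm A (Function.update (fun r => x r (σ r)) i (p • x i 0 + q • x i 1)) =
      p * tensorForm A (fun r => x r (Function.update σ i 0 r)) +
        q * tensorForm A (fun r => x r (Function.update σ i 1 r)) := by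
  rw [MultilinearMap.map_update_add, MultilinearMap.map_update_smul,
    MultilinearMap.map_update_smul, update_basis_index, update_basis_index, smul_eq_mul,
    smul_eq_mul]

/-- A nonzero vector that annihilates slot `i` gives a linear relation between the two slices of the
tensor in slot `i`, so that their `2 × 2` minors vanish. -/
theorem tensorForm_minors_of_update_eq_zero (x : ∀ r, Basis (Fin 2) ℂ (V r)) {A : TensorDual V}
    {i : Fin m} {z : V i} (hz : z ≠ 0) (h : ∀ u, tensorForm A (Function.update u i z) = 0)
    (σ σ' : Fin m → Fin 2) :
    tensorForm A (fun r => x r (Function.update σ i 0 r)) *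
        tensorForm A (fun r => x r (Function.update σ' i 1 r)) =
      tensorForm A (fun r => x r (Function.update σ' i 0 r)) *
        tensorForm A (fun r => x r (Function.update σ i 1 r)) := by
  have hsum := (x i).sum_repr z
  rw [Fin.sum_univ_two] at hsum
  have hrel (σ : Fin m → Fin 2) := tensorForm_update_basis x A σ i ((x i).repr z 0) ((x i).repr z 1)
  simp only [hsum, h] at hrel
  have h1 := hrel σ
  have h2 := hrel σ'
  by_cases h0 : (x i).repr z 0 = 0
  · have h0' : (x i).repr z 1 ≠ 0 := fun h3 => hz (by rw [← hsum, h0, h3]; simp)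
    refine mul_left_cancel₀ h0' ?_
    linear_combination tensorForm A (fun r => x r (Function.update σ' i 0 r)) * h1 -
      tensorForm A (fun r => x r (Function.update σ i 0 r)) * h2
  · refine mul_left_cancel₀ h0 ?_
    linear_combination tensorForm A (fun r => x r (Function.update σ i 1 r)) * h2 -
      tensorForm A (fun r => x r (Function.update σ' i 1 r)) * h1

/-- A curve of tensors, polynomial of degree one in each slot in `S` and constant in the other
slots, is the product of linear images of the parameter with a constant tensor. -/
theorem exists_eq_joinSlots (hV : ∀ r, finrank ℂ (V r) = 2) (x : ∀ r, Basis (Fin 2) ℂ (V r))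
    (j : Fin m) (S : Finset (Fin m)) {a : Fin m → Fin 2 → Polynomial ℂ}
    {C : (Fin m → Fin 2) → Polynomial ℂ} (hC : ∀ σ σ', (∀ r ∉ S, σ r = σ' r) → C σ = C σ')
    (ha : ∀ i ∈ S, IsCoprime (a i 0) (a i 1)) (ha1 : ∀ i ∈ S, ∀ k, (a i k).natDegree ≤ 1)
    (ha2 : ∀ i ∈ S, ∃ k, 1 ≤ (a i k).natDegree) (hC0 : ∀ σ, (C σ).natDegree = 0)
    {A : ℂ → TensorDual V}
    (hA : ∀ t σ, tensorForm (A t) (fun r => x r (σ r)) =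
      ((∏ r ∈ S, a r (σ r)) * C σ).eval t) :
    ∃ (K : (r : {r : Fin m // r ∈ S}) → V j ≃ₗ[ℂ] Dual ℂ (V r))
      (γ : ⨂[ℂ] r : {r : Fin m // r ∉ S}, Dual ℂ (V r)),
      ∀ t, A t = joinSlots V S
        (PiTensorProduct.tprod ℂ (fun r => K r (x j 0 + t • x j 1)) ⊗ₜ[ℂ] γ) := by
  have (r : Fin m) : FiniteDimensional ℂ (V r) := finite_of_finrank_pos (by rw [hV]; omega)
  have hK (r : {r : Fin m // r ∈ S}) : ∃ K : V j ≃ₗ[ℂ] Dual ℂ (V r),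
      ∀ (t : ℂ) k, K (x j 0 + t • x j 1) (x r k) = (a r k).eval t := by
    let K : V j →ₗ[ℂ] Dual ℂ (V r) := (x j).constr ℂ fun l : Fin 2 =>
      (x r).constr ℂ fun k : Fin 2 => (a r k).coeff l
    have hKx (l k : Fin 2) : K (x j l) (x r k) = (a r k).coeff l := by
      simp only [K, Basis.constr_basis]
    have hinj : Function.Injective K := by
      refine (injective_iff_map_eq_zero K).2 fun v hv => ?_
      have hsum := (x j).sum_repr v
      rw [Fin.sum_univ_two] at hsum
      have hk (k : Fin 2) :
          (x j).repr v 0 * (a r k).coeff 0 + (x j).repr v 1 * (a r k).coeff 1 = 0 := by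
        have := LinearMap.congr_fun hv (x r k)
        rw [← hsum, map_add, map_smul, map_smul, LinearMap.add_apply, LinearMap.smul_apply,
          LinearMap.smul_apply, hKx, hKx] at this
        exact this
      have hdet := coeff_det_ne_zero (ha r r.2) (ha1 r r.2) (ha2 r r.2)
      have h0 := hk 0
      have h1 := hk 1
      have hv0 : (x j).repr v 0 = 0 := by
        refine (mul_eq_zero.1 ?_).resolve_right hdet
        linear_combination (a r 1).coeff 1 * h0 - (a r 0).coeff 1 * h1
      have hv1 : (x j).repr v 1 = 0 := by
        refine (mul_eq_zero.1 ?_).resolve_right hdet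
        linear_combination (a r 0).coeff 0 * h1 - (a r 1).coeff 0 * h0
      rw [← hsum, hv0, hv1, zero_smul, zero_smul, add_zero]
    refine ⟨LinearEquiv.ofInjectiveOfFinrankEq K hinj
      (by rw [Subspace.dual_finrank_eq, hV, hV]), fun t k => ?_⟩
    change K (x j 0 + t • x j 1) (x r k) = _
    conv_rhs => rw [Polynomial.eq_X_add_C_of_natDegree_le_one (ha1 r r.2 k)]
    rw [map_add, map_smul, LinearMap.add_apply, LinearMap.smul_apply, hKx, hKx]
    simp only [Fin.val_zero, Fin.val_one, smul_eq_mul, Polynomial.eval_add, Polynomial.eval_mul,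
      Polynomial.eval_C, Polynomial.eval_X]
    ring
  choose K hK using hK
  obtain ⟨γ, hγ⟩ := exists_tensorForm_basis_eq
    (M := fun r : {r : Fin m // r ∉ S} => V r) (fun r => x r) fun ρ =>
      (C fun r => if h : r ∈ S then 0 else ρ ⟨r, h⟩).coeff 0
  refine ⟨K, γ, fun t => tensorForm_ext_basis x fun σ => ?_⟩
  have hγσ : tensorForm γ (fun r : {r : Fin m // r ∉ S} => x r (σ r)) = (C σ).eval t := by
    rw [hγ (fun r => σ r), hC _ σ fun r hr => dif_neg hr]
    conv_rhs => rw [Polynomial.eq_C_of_natDegree_eq_zero (hC0 σ), Polynomial.eval_C]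
  rw [hA, tensorForm_joinSlots, hγσ, Polynomial.eval_mul, Polynomial.eval_prod]
  congr 1
  rw [← Finset.prod_coe_sort]
  exact Finset.prod_congr rfl fun r _ => (hK r t (σ r)).symm

end Parametrized

namespace FactorizationStructure

open Filter

variable {m : ℕ} {V : Fin m → Type*} [∀ r, AddCommGroup (V r)] [∀ r, Module ℂ (V r)]
  {𝔥 : Type*} [AddCommGroup 𝔥] [Module ℂ 𝔥] (φ : FactorizationStructure V 𝔥)

theorem isRegularOfDegree_curveDegree (j : Fin m) :
    IsRegularOfDegree (φ.curve j) (φ.curveDegree j) :=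
  Nat.sInf_mem (s := {d : ℕ | IsRegularOfDegree (φ.curve j) d}) (φ.isCurveExtension_curve j).1

/-- The curve `ψ_j` is injective: the image under `φ` of a common value at two different points is
annihilated by two independent vectors in slot `j`. -/
theorem curve_ne_of_linearIndependent {j : Fin m} {v w : V j} (hvw : LinearIndependent ℂ ![v, w])
    (hv : v ≠ 0) (hw : w ≠ 0) :
    φ.curve j (Projectivization.mk ℂ v hv) ≠ φ.curve j (Projectivization.mk ℂ w hw) := by
  have := φ.finiteDimensional_slot
  intro h
  set y := (φ.curve j (Projectivization.mk ℂ v hv)).rep with hy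
  have hyv : y ∈ (φ.curve j (Projectivization.mk ℂ v hv)).submodule := by
    rw [Projectivization.submodule_eq]
    exact Submodule.mem_span_singleton_self _
  have hyw : y ∈ (φ.curve j (Projectivization.mk ℂ w hw)).submodule := h ▸ hyv
  have hφy : φ.toLinearMap y = 0 := eq_zero_of_slot_eq_zero (φ.finrank_slot j) hvw
    ((mem_slotAnnihilator_mk hv).1 (φ.mem_slotAnnihilator_of_mem_curve j _ hyv))
    ((mem_slotAnnihilator_mk hw).1 (φ.mem_slotAnnihilator_of_mem_curve j _ hyw))
  exact Projectivization.rep_nonzero _ (φ.injective (hφy.trans (map_zero _).symm))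

/-- If `Im ψ_i = Im ψ_j`, no fixed vector `z` annihilates slot `i` of `φ (ψ_j ℓ)` at two different
points `ℓ`: both values would be `ψ_i [z]`. -/
theorem exists_tensorForm_update_ne_zero {i j : Fin m} (hij : φ.CurvesEquivalent i j)
    {v w : V j} (hvw : LinearIndependent ℂ ![v, w]) (hv : v ≠ 0) (hw : w ≠ 0) {a b : 𝔥}
    (ha0 : a ≠ 0) (hb0 : b ≠ 0)
    (ha : φ.curve j (Projectivization.mk ℂ v hv) = Projectivization.mk ℂ a ha0)
    (hb : φ.curve j (Projectivization.mk ℂ w hw) = Projectivization.mk ℂ b hb0)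
    {z : V i} (hz : z ≠ 0) :
    ¬ ((∀ u, tensorForm (φ.toLinearMap a) (Function.update u i z) = 0) ∧
      ∀ u, tensorForm (φ.toLinearMap b) (Function.update u i z) = 0) := by
  have := φ.finiteDimensional_slot
  have key {v : V j} {hv : v ≠ 0} {a : 𝔥} (ha0 : a ≠ 0)
      (ha : φ.curve j (Projectivization.mk ℂ v hv) = Projectivization.mk ℂ a ha0)
      (h : ∀ u, tensorForm (φ.toLinearMap a) (Function.update u i z) = 0) :
      φ.curve j (Projectivization.mk ℂ v hv) = φ.curve i (Projectivization.mk ℂ z hz) := by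
    obtain ⟨ℓ, hℓ⟩ : φ.curve j (Projectivization.mk ℂ v hv) ∈ Set.range (φ.curve i) :=
      hij ▸ Set.mem_range_self _
    induction ℓ using Projectivization.ind with | h y hy =>
    rw [← hℓ]
    congr 1
    refine (mk_eq_mk_of_mem_span hz hy ?_).symm
    by_contra hyz
    have hind : LinearIndependent ℂ ![z, y] := by
      refine (LinearIndependent.pair_iff' hz).2 fun c hc => hyz ?_
      exact Submodule.mem_span_singleton.2 ⟨c, hc⟩
    have hmem : a ∈ (φ.curve i (Projectivization.mk ℂ y hy)).submodule := by
      rw [hℓ, ha]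
      exact Submodule.mem_span_singleton_self _
    exact ha0 (φ.injective ((eq_zero_of_slot_eq_zero (φ.finrank_slot i) hind h
      ((mem_slotAnnihilator_mk hy).1 (φ.mem_slotAnnihilator_of_mem_curve i _ hmem))).trans
      (map_zero _).symm))
  rintro ⟨h1, h2⟩
  exact φ.curve_ne_of_linearIndependent hvw hv hw ((key ha0 ha h1).trans (key hb0 hb h2).symm)

theorem map_curve_eq_span {j : Fin m} {v : V j} {hv : v ≠ 0} {y : 𝔥} (hy : y ≠ 0)
    (h : φ.curve j (Projectivization.mk ℂ v hv) = Projectivization.mk ℂ y hy) {A : TensorDual V}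
    (hA : φ.toLinearMap y ∈ ℂ ∙ A) :
    (φ.curve j (Projectivization.mk ℂ v hv)).submodule.map φ.toLinearMap = ℂ ∙ A := by
  rw [h, Projectivization.submodule_mk, Submodule.map_span, Set.image_singleton]
  refine le_antisymm ((Submodule.span_singleton_le_iff_mem _ _).2 hA)
    ((Submodule.span_singleton_le_iff_mem _ _).2 ?_)
  obtain ⟨c, hc⟩ := Submodule.mem_span_singleton.1 hA
  have hc0 : c ≠ 0 := by
    rintro rfl
    rw [zero_smul] at hc
    exact hy (φ.injective (hc.symm.trans (map_zero _).symm))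
  exact Submodule.mem_span_singleton.2 ⟨c⁻¹, by rw [← hc, smul_smul, inv_mul_cancel₀ hc0, one_smul]⟩

/-- If `ψ_j` is a product of linear factors along an affine line, then it is so everywhere: on the
cone of the line by homogeneity, and at the point at infinity by continuity. -/
theorem map_curve_eq_of_line {j : Fin m} {S : Finset (Fin m)} {e₀ e₁ : V j}
    (he : LinearIndependent ℂ ![e₀, e₁])
    (K : (r : {r : Fin m // r ∈ S}) → V j ≃ₗ[ℂ] Dual ℂ (V r))
    {γ : ⨂[ℂ] r : {r : Fin m // r ∉ S}, Dual ℂ (V r)} (hγ : γ ≠ 0)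
    (h : ∀ t : ℂ, (φ.curve j (Projectivization.mk ℂ (e₀ + t • e₁)
      (add_smul_ne_zero he t))).submodule.map φ.toLinearMap = Submodule.span ℂ
        {joinSlots V S (PiTensorProduct.tprod ℂ (fun r => K r (e₀ + t • e₁)) ⊗ₜ[ℂ] γ)})
    (v : V j) (hv : v ≠ 0) :
    (φ.curve j (Projectivization.mk ℂ v hv)).submodule.map φ.toLinearMap = Submodule.span ℂ
        {joinSlots V S (PiTensorProduct.tprod ℂ (fun r => K r v) ⊗ₜ[ℂ] γ)} := by
  have := φ.finiteDimensional_slot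
  have hcone {p q : ℂ} (hp : p ≠ 0) (hv : p • e₀ + q • e₁ ≠ 0) :
      (φ.curve j (Projectivization.mk ℂ (p • e₀ + q • e₁) hv)).submodule.map φ.toLinearMap =
        Submodule.span ℂ
        {joinSlots V S (PiTensorProduct.tprod ℂ (fun r => K r (p • e₀ + q • e₁)) ⊗ₜ[ℂ] γ)} := by
    have hpq : p • e₀ + q • e₁ = p • (e₀ + (q / p) • e₁) := by
      rw [smul_add, smul_smul, mul_div_cancel₀ _ hp]
    have hmk : Projectivization.mk ℂ (p • e₀ + q • e₁) hv =
        Projectivization.mk ℂ (e₀ + (q / p) • e₁) (add_smul_ne_zero he _) :=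
      (Projectivization.mk_eq_mk_iff' ℂ _ _ _ _).2 ⟨p, hpq.symm⟩
    have hne (v : V j) (hv : v ≠ 0) (r : {r : Fin m // r ∈ S}) : K r v ≠ 0 :=
      (K r).map_ne_zero_iff.2 hv
    rw [hmk, h, ← productLine_mk S _ (hne _ (add_smul_ne_zero he _)) γ hγ,
      ← productLine_mk S _ (hne _ hv) γ hγ]
    congr 1
    funext r
    refine ((Projectivization.mk_eq_mk_iff' ℂ _ _ _ _).2 ⟨p, ?_⟩).symm
    rw [hpq, map_smul]
  obtain ⟨p, q, hpq⟩ := exists_eq_add_of_pair (φ.finrank_slot j) he v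
  by_cases hp : p = 0
  · rw [hp, zero_smul, zero_add] at hpq
    subst hpq
    obtain ⟨F, hF, hF'⟩ := (φ.isCurveExtension_curve j).1.exists_line (q • e₁) e₀
    have hne (t : ℂ) (ht : t ≠ 0) : q • e₁ + t • e₀ ≠ 0 := fun h0 => by
      rw [add_comm] at h0
      exact ht (LinearIndependent.pair_iff.1 he t q h0).1
    let A : ℂ → TensorDual V := fun t =>
      joinSlots V S (PiTensorProduct.tprod ℂ (fun r => K r (q • e₁ + t • e₀)) ⊗ₜ[ℂ] γ)
    have hFA (t : ℂ) (ht : t ≠ 0) : φ.toLinearMap (F t) ∈ ℂ ∙ A t := by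
      obtain ⟨h1, h2⟩ := hF' t (hne t ht)
      have h3 := hcone (q := q) ht (by rw [add_comm]; exact hne t ht)
      simp only [add_comm (t • e₀)] at h3
      rw [← h3, h2]
      exact Submodule.mem_map_of_mem (Submodule.mem_span_singleton_self _)
    have hcF (u : ∀ r, V r) : Continuous fun t => tensorForm (φ.toLinearMap (F t)) u :=
      hF ((PiTensorProduct.dualDistrib.flip (PiTensorProduct.tprod ℂ u)) ∘ₗ φ.toLinearMap)
    have hcA (u : ∀ r, V r) : Continuous fun t => tensorForm (A t) u := by
      simp only [A, tensorForm_joinSlots, map_add, map_smul, LinearMap.add_apply,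
        LinearMap.smul_apply, smul_eq_mul]
      fun_prop
    have hmin (u u' : ∀ r, V r) (t : ℂ) :
        tensorForm (A t) u * tensorForm (φ.toLinearMap (F t)) u' =
          tensorForm (A t) u' * tensorForm (φ.toLinearMap (F t)) u := by
      refine eq_of_eventually_cofinite_eq ((hcA u).mul (hcF u')) ((hcA u').mul (hcF u)) ?_ t
      filter_upwards [(Set.finite_singleton (0 : ℂ)).compl_mem_cofinite] with t ht
      exact minors_of_mem_span_singleton
        (fun u => PiTensorProduct.dualDistrib.flip (PiTensorProduct.tprod ℂ u)) (hFA t ht) u u'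
    have h00 : q • e₁ + (0 : ℂ) • e₀ = q • e₁ := by rw [zero_smul, add_zero]
    obtain ⟨h1, h2⟩ := hF' 0 (by rwa [h00])
    simp only [h00] at h2
    refine φ.map_curve_eq_span h1 h2 ?_
    have hA0 : joinSlots V S (PiTensorProduct.tprod ℂ (fun r => K r (q • e₁)) ⊗ₜ[ℂ] γ) = A 0 := by
      simp only [A, h00]
    rw [hA0]
    refine mem_span_singleton_of_minors
      (fun u => PiTensorProduct.dualDistrib.flip (PiTensorProduct.tprod ℂ u)) (fun T hT => ?_) ?_
      fun u u' => hmin u u' 0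
    · refine tensorForm_bijective.1 ?_
      rw [map_zero]
      exact MultilinearMap.ext hT
    · rw [← hA0]
      exact joinSlots_tprod_ne_zero S (fun r => (K r).map_ne_zero_iff.2 hv) hγ
  · subst hpq
    exact hcone hp hv

/-- A curve of degree `d` with `d` curves in its class is a product of `d` linear factors: each of
these slots contributes a factor of positive degree. -/
theorem exists_isSlotForm {j : Fin m} (h : φ.IsDecomposableCurve j) :
    ∃ (S : Finset (Fin m)) (Γ : ℙ ℂ (⨂[ℂ] r : {r : Fin m // r ∉ S}, Dual ℂ (V r)))
      (g : (r : {r : Fin m // r ∈ S}) → ℙ ℂ (Dual ℂ (V j)) → ℙ ℂ (Dual ℂ (V r))),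
      φ.IsSlotForm j S Γ g := by
  have := φ.finiteDimensional_slot
  obtain ⟨S, hS⟩ : ∃ S : Finset (Fin m), (S : Set (Fin m)) = {i | φ.CurvesEquivalent i j} :=
    (Set.toFinite _).exists_finset_coe
  have hSmem {i : Fin m} (hi : i ∈ S) : φ.CurvesEquivalent i j := by
    have : i ∈ (S : Set (Fin m)) := hi
    rwa [hS] at this
  have hcard : S.card = φ.curveDegree j := by
    rw [← h, ← hS, Set.ncard_coe_finset]
  let x : ∀ r, Basis (Fin 2) ℂ (V r) := fun r => finBasisOfFinrankEq ℂ (V r) (φ.finrank_slot r)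
  have hx := linearIndependent_basis_pair (x j)
  obtain ⟨F, hF, hF'⟩ := (φ.isRegularOfDegree_curveDegree j).exists_line (x j 0) (x j 1)
  have hF0 (t : ℂ) : F t ≠ 0 := (hF' t (add_smul_ne_zero hx t)).1
  have hFc (t : ℂ) : φ.curve j (Projectivization.mk ℂ (x j 0 + t • x j 1)
      (add_smul_ne_zero hx t)) = Projectivization.mk ℂ (F t) (hF0 t) :=
    (hF' t (add_smul_ne_zero hx t)).2
  choose T hTd hT using fun σ : Fin m → Fin 2 =>
    hF ((PiTensorProduct.dualDistrib.flip (PiTensorProduct.tprod ℂ fun r => x r (σ r))) ∘ₗ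
      φ.toLinearMap)
  replace hT (σ : Fin m → Fin 2) (t : ℂ) :
      tensorForm (φ.toLinearMap (F t)) (fun r => x r (σ r)) = (T σ).eval t := hT σ t
  have hT0 : ∃ σ, T σ ≠ 0 := by
    by_contra! h0
    refine hF0 0 (φ.injective ?_)
    rw [map_zero]
    refine tensorForm_ext_basis x fun σ => ?_
    rw [hT, h0, Polynomial.eval_zero, map_zero]
    rfl
  have hmin : ∀ i ∈ S, ∀ σ σ', T (Function.update σ i 0) * T (Function.update σ' i 1) =
      T (Function.update σ' i 0) * T (Function.update σ i 1) := by
    intro i hi σ σ'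
    refine Polynomial.funext fun t => ?_
    obtain ⟨ℓ, hℓ⟩ : φ.curve j (Projectivization.mk ℂ (x j 0 + t • x j 1)
        (add_smul_ne_zero hx t)) ∈ Set.range (φ.curve i) := hSmem hi ▸ Set.mem_range_self _
    induction ℓ using Projectivization.ind with | h z hz =>
    have hmem : F t ∈ (φ.curve i (Projectivization.mk ℂ z hz)).submodule := by
      rw [hℓ, hFc]
      exact Submodule.mem_span_singleton_self _
    have := tensorForm_minors_of_update_eq_zero x hz
      ((mem_slotAnnihilator_mk hz).1 (φ.mem_slotAnnihilator_of_mem_curve i _ hmem)) σ σ'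
    rwa [hT, hT, hT, hT, ← Polynomial.eval_mul, ← Polynomial.eval_mul] at this
  obtain ⟨a, C, ha, hC, hTC⟩ := exists_slots_factors S hmin hT0
  have ha2 : ∀ i ∈ S, ∃ k, 1 ≤ (a i k).natDegree := by
    intro i hi
    by_contra! hlt
    have hconst (k : Fin 2) : a i k = Polynomial.C ((a i k).coeff 0) :=
      Polynomial.eq_C_of_natDegree_eq_zero (by have := hlt k; omega)
    -- the constant vector `z` annihilated by the constant factor in slot `i`
    let z : V i := (a i 1).coeff 0 • x i 0 + (-(a i 0).coeff 0) • x i 1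
    have hz : z ≠ 0 := by
      intro h0
      obtain ⟨h1, h2⟩ := LinearIndependent.pair_iff.1 (linearIndependent_basis_pair (x i)) _ _ h0
      have h3 : a i 0 = 0 := by rw [hconst, neg_eq_zero.1 h2, map_zero]
      have h4 : a i 1 = 0 := by rw [hconst, h1, map_zero]
      rcases (ha i hi).ne_zero_or_ne_zero with h | h
      · exact h h3
      · exact h h4
    have hTk (σ : Fin m → Fin 2) (k : Fin 2) : T (Function.update σ i k) =
        a i k * ((∏ r ∈ S.erase i, a r (σ r)) * C σ) := by
      have hCσ : C (Function.update σ i k) = C σ := hC _ _ fun r hr =>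
        Function.update_of_ne (by rintro rfl; exact hr hi) _ _
      rw [hTC, hCσ, ← Finset.mul_prod_erase S _ hi, Function.update_self, mul_assoc]
      congr 2
      refine Finset.prod_congr rfl fun r hr => ?_
      rw [Function.update_of_ne (Finset.ne_of_mem_erase hr)]
    have hker (t : ℂ) (u : ∀ r, V r) :
        tensorForm (φ.toLinearMap (F t)) (Function.update u i z) = 0 := by
      refine tensorForm_update_eq_zero x (fun σ => ?_) u
      rw [tensorForm_update_basis, hT, hT, hTk, hTk, hconst 0, hconst 1]
      simp only [Polynomial.eval_mul, Polynomial.eval_C, Polynomial.coeff_C_zero]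
      ring
    have hind : LinearIndependent ℂ ![x j 0 + (0 : ℂ) • x j 1, x j 0 + (1 : ℂ) • x j 1] := by
      refine LinearIndependent.pair_iff.2 fun p q hpq => ?_
      have h1 := LinearIndependent.pair_iff.1 hx (p + q) q (by rw [← hpq]; module)
      exact ⟨by linear_combination h1.1 - h1.2, h1.2⟩
    exact φ.exists_tensorForm_update_ne_zero (hSmem hi) hind _ _ (hF0 0) (hF0 1) (hFc 0) (hFc 1) hz
      ⟨hker 0, hker 1⟩
  obtain ⟨ha1, hC0⟩ := natDegree_slots_factors hC hTC (fun σ => hcard ▸ hTd σ) hT0 ha2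
  obtain ⟨K, γ, hKγ⟩ := exists_eq_joinSlots φ.finrank_slot x j S hC ha ha1 ha2 hC0
    (A := fun t => φ.toLinearMap (F t)) (fun t σ => by rw [hT, hTC])
  have hγ : γ ≠ 0 := by
    rintro rfl
    have := hKγ 0
    rw [TensorProduct.tmul_zero, map_zero] at this
    exact hF0 0 (φ.injective (this.trans (map_zero _).symm))
  have hmap := φ.map_curve_eq_of_line hx K hγ fun t => by
    refine φ.map_curve_eq_span (hF0 t) (hFc t) ?_
    rw [hKγ]
    exact Submodule.mem_span_singleton_self _
  obtain ⟨J, hJ⟩ := exists_equiv_dual_self_apply_eq_zero (φ.finrank_slot j)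
  refine ⟨S, Projectivization.mk ℂ γ hγ, fun r => Projectivization.map
    (J.symm.trans (K r)).toLinearMap (J.symm.trans (K r)).injective, hcard, fun r => ⟨_, rfl⟩,
    fun ℓ => ?_⟩
  induction ℓ using Projectivization.ind with | h v hv =>
  rw [hmap, φ.productLine_annihilatorPoint hJ S (fun r => J.symm.trans (K r)) hγ hv]
  simp only [LinearEquiv.trans_apply, LinearEquiv.symm_apply_apply]

end FactorizationStructure

theorem theorem2p9 {m : ℕ} {V : Fin m → Type*} [∀ r, AddCommGroup (V r)] [∀ r, Module ℂ (V r)]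
    {𝔥 : Type*} [AddCommGroup 𝔥] [Module ℂ 𝔥] (φ : FactorizationStructure V 𝔥) (j : Fin m) :
    (φ.IsDecomposableCurve j ↔
      ∃ (S : Finset (Fin m)) (Γ : ℙ ℂ (⨂[ℂ] r : {r : Fin m // r ∉ S}, Dual ℂ (V r)))
        (g : (r : {r : Fin m // r ∈ S}) → ℙ ℂ (Dual ℂ (V j)) → ℙ ℂ (Dual ℂ (V r))),
        φ.IsSlotForm j S Γ g) ∧
    ∀ (S : Finset (Fin m)) (Γ : ℙ ℂ (⨂[ℂ] r : {r : Fin m // r ∉ S}, Dual ℂ (V r)))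
      (g : (r : {r : Fin m // r ∈ S}) → ℙ ℂ (Dual ℂ (V j)) → ℙ ℂ (Dual ℂ (V r))),
      φ.IsSlotForm j S Γ g → ∃ hj : j ∈ S, g ⟨j, hj⟩ = id :=
  ⟨⟨φ.exists_isSlotForm, fun ⟨_, _, _, h⟩ => h.isDecomposableCurve⟩,
    fun _ _ _ h => ⟨h.self_mem, h.apply_self_eq_id⟩⟩
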